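/- Let $K$ be an algebraically closed field of characteristic $0$, let $d \ge 0$, and let $\mathbb{N} = \{0,1,2,\ldots\}$. For $\mathbf n \in \mathbb{N}^d$ and $\boldsymbol\alpha \in (K^*)^d$ write $\mathbf x^{\mathbf n} = x_1^{n_1}\cdots x_d^{n_d}$ and $\boldsymbol\alpha^{\mathbf n} = \alpha_1^{n_1}\cdots\alpha_d^{n_d}$. A subset $\mathcal S \subseteq \mathbb{N}^d$ is called simple linear if $\mathcal S = \mathbf a + \mathbf b_1\mathbb{N} + \cdots + \mathbf b_s\mathbb{N}$ for some $s \ge 0$ and $\mathbf a, \mathbf b_1, \ldots, \mathbf b_s \in \mathbb{N}^d$ with $\mathbf b_1,\ldots,\mathbf b_s$ linearly independent over $\mathbb{Z}$. For a power series $F = \sum_{\mathbf n \in \mathbb{N}^d} f(\mathbf n)\,\mathbf x^{\mathbf n} \in K[[x_1,\ldots,x_d]]$ the following statements are equivalent. (a) There exist $l \ge 0$, $c_1,\ldots,c_l \in K^*$, non-constant monomials $u_1,\ldots,u_l$ in $x_1,\ldots,x_d$ (that is, $u_i = \mathbf x^{\mathbf e_i}$ with $\mathbf 0 \ne \mathbf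 e_i \in \mathbb{N}^d$), and a polynomial $P \in K[x_1,\ldots,x_d]$ such that $$F = \frac{P}{(1-c_1u_1)\cdots(1-c_lu_l)}.$$ (b) The sequence $f$ is piecewise polynomial-exponential on simple linear subsets of $\mathbb{N}^d$: there exists a partition of $\mathbb{N}^d$ into finitely many simple linear sets $\mathcal S_1,\ldots,\mathcal S_m$ such that for each $i \in \{1,\ldots,m\}$ there exist $k_i \in \mathbb{N}$, polynomials $A_{i,1},\ldots,A_{i,k_i} \in K[x_1,\ldots,x_d]$ and vectors $\boldsymbol\alpha_{i,1},\ldots,\boldsymbol\alpha_{i,k_i} \in (K^*)^d$ with $$f(\mathbf n) = \sum_{j=1}^{k_i} A_{i,j}(\mathbf n)\,\boldsymbol\alpha_{i,j}^{\mathbf n} \qquad \text{for all } \mathbf n \in \mathcal S_i.$$ -/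

import Mathlib

/-- A subset of `ℕ^d` is *simple linear* if it is of the form `a + b₁ ℕ + ⋯ + bₛ ℕ` with
`a, b₁, …, bₛ ∈ ℕ^d` and `b₁, …, bₛ` linearly independent over `ℤ`. -/
def IsSimpleLinear {d : ℕ} (S : Set (Fin d → ℕ)) : Prop :=
  ∃ (s : ℕ) (a : Fin d → ℕ) (b : Fin s → Fin d → ℕ),
    LinearIndependent ℤ (fun (j : Fin s) (i : Fin d) => (b j i : ℤ)) ∧
      S = {n | ∃ m : Fin s → ℕ, n = a + ∑ j, m j • b j}

/-- A function `f : ℕ^d → K` is *polynomial-exponential* on `S ⊆ ℕ^d` if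
`f(n) = ∑ⱼ Aⱼ(n) αⱼ^n` for all `n ∈ S`, for finitely many polynomials `Aⱼ ∈ K[x₁, …, x_d]` and
vectors `αⱼ ∈ (K^*)^d`, where `αⱼ^n = ∏ᵢ αⱼᵢ^nᵢ`. -/
def IsPolyExpOn {K : Type*} [Field K] {d : ℕ} (f : (Fin d → ℕ) → K) (S : Set (Fin d → ℕ)) :
    Prop :=
  ∃ (k : ℕ) (A : Fin k → MvPolynomial (Fin d) K) (α : Fin k → Fin d → Kˣ),
    ∀ n ∈ S, f n =
      ∑ j, MvPolynomial.eval (fun i => (n i : K)) (A j) * ∏ i, (α j i : K) ^ n i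

/-- A function `f : ℕ^d → K` is *piecewise polynomial-exponential on simple linear subsets of
`ℕ^d`* if `ℕ^d` has a partition into finitely many simple linear sets on each of which `f` is
polynomial-exponential. (Simple linear sets are non-empty, so the blocks are non-empty.) -/
def IsPiecewisePolyExp {K : Type*} [Field K] {d : ℕ} (f : (Fin d → ℕ) → K) : Prop :=
  ∃ (m : ℕ) (S : Fin m → Set (Fin d → ℕ)),
    (∀ i, IsSimpleLinear (S i)) ∧ Pairwise (fun i j => Disjoint (S i) (S j)) ∧
      (⋃ i, S i) = Set.univ ∧ ∀ i, IsPolyExpOn f (S i)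

/-- The coefficient sequence `f : ℕ^d → K` of `F = ∑ₙ f(n) x^n ∈ K⟦x₁, …, x_d⟧`. -/
noncomputable def coeffSeq {K : Type*} [Field K] {d : ℕ} (F : MvPowerSeries (Fin d) K) (n : Fin d → ℕ) : K :=
  MvPowerSeries.coeff (Finsupp.equivFunOnFinite.symm n) F

/-- `F = P / ((1 - c₁u₁) ⋯ (1 - c_l u_l))` in `K⟦x₁, …, x_d⟧` for a polynomial `P`, scalars
`cᵢ ∈ K^*` and non-constant monomials `uᵢ = x^(eᵢ)`, `eᵢ ≠ 0`. The denominator has constant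
coefficient `1`, so that `⁻¹` is its inverse in the ring of power series. -/
def HasGeometricDenominator {K : Type*} [Field K] {d : ℕ} (F : MvPowerSeries (Fin d) K) : Prop :=
  ∃ (P : MvPolynomial (Fin d) K) (l : ℕ) (c : Fin l → Kˣ) (e : Fin l → Fin d →₀ ℕ),
    (∀ i, e i ≠ 0) ∧
      F = (P : MvPowerSeries (Fin d) K) *
        ((∏ i, (1 - MvPolynomial.C (c i : K) * MvPolynomial.monomial (e i) 1) :
          MvPolynomial (Fin d) K) : MvPowerSeries (Fin d) K)⁻¹

open Function

/-! From (b) to (a): elements of a simple linear set have unique coordinates, so the indicator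
series of `a + b₁ℕ + ⋯ + bₛℕ` is `x^a / ∏ (1 - x^(bⱼ))`. Multiplying coefficients by `α^n` is the
substitution `xᵢ ↦ αᵢ xᵢ`, and multiplying them by `nᵢ` is the Euler operator `xᵢ ∂/∂xᵢ`. Both
preserve the fractions in (a), which are closed under sums
(`IsPiecewisePolyExp.isGeometricRational`).

From (a) to (b): partial fractions (`mem_closure_independentFractions`) reduce to denominators with
linearly independent exponent vectors. A relation between exponents yields `∑_I rᵢ eᵢ = ∑_J rⱼ eⱼ =
E`; factors can then be traded for some `1 - γ x^E`, or dropped, so that their number falls. When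
the exponents are independent, each monomial of the numerator contributes a sequence supported on
one simple linear set, equal there to a product of terms `cⱼ^mⱼ q(mⱼ)` in the coordinates `mⱼ`.
These coordinates are rational affine functions of `n`, so after extracting roots of the `cⱼ` the
product is polynomial-exponential in `n` (`IsPolyExpOn.of_coordinates`).

The supports of these sequences overlap, so a common refinement into disjoint simple linear sets is
needed. Membership in a simple linear set amounts to linear inequalities, equations and congruences
(`IsSimpleLinear.refinable_mem`), and `ℕ^d` splits into simple linear sets on which a given
condition of this kind is constant (`decomposable_constOn_le`, `decomposable_constOn_mod`).
`Refinable` demands this after every affine pullback, so that conditions can be imposed one after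
another. -/

/-! ### Simple linear sets as injective affine images, and their finite disjoint unions -/

theorem linearIndependent_natCast_iff_injective {ι : Type*} [Fintype ι] {d : ℕ}
    (b : ι → Fin d → ℕ) :
    LinearIndependent ℤ (fun (j : ι) (i : Fin d) => (b j i : ℤ)) ↔
      Injective (Fintype.linearCombination ℕ b) := by
  rw [Fintype.linearIndependent_iff]
  constructor
  · intro h m m' hm
    have := h (fun j => (m j : ℤ) - m' j) (by
      funext i
      have := congrFun hm i
      simp only [Fintype.linearCombination_apply, Finset.sum_apply, Pi.smul_apply, smul_eq_mul]
        at this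
      have h2 : (∑ j, (m j : ℤ) * b j i) = ∑ j, (m' j : ℤ) * b j i := by exact_mod_cast this
      simp [Finset.sum_apply, sub_mul, h2])
    funext j
    have := this j
    omega
  · intro h g hg j
    -- The positive and negative parts of the relation `g` have the same image, hence agree.
    have := @h (fun j => (g j).toNat) (fun j => (-g j).toNat) (by
      funext i
      have := congrFun hg i
      simp only [Fintype.linearCombination_apply, Finset.sum_apply, Pi.smul_apply, smul_eq_mul,
        Pi.zero_apply] at this ⊢
      zify
      rw [← sub_eq_zero, ← Finset.sum_sub_distrib, ← this]
      refine Finset.sum_congr rfl fun j _ => ?_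
      rw [← sub_mul]
      congr 1
      omega)
    have : (g j).toNat = (-g j).toNat := congrFun this j
    omega

theorem isSimpleLinear_range {ι : Type*} [Finite ι] {d : ℕ} (a : Fin d → ℕ)
    (L : (ι → ℕ) →ₗ[ℕ] (Fin d → ℕ)) (hL : Injective L) :
    IsSimpleLinear (Set.range fun m => a + L m) := by
  classical
  obtain ⟨s, ⟨eqv⟩⟩ := Finite.exists_equiv_fin ι
  let L' : (Fin s → ℕ) →ₗ[ℕ] (Fin d → ℕ) := L ∘ₗ (LinearMap.funLeft ℕ ℕ eqv)
  have hL' : ⇑L' = ⇑(Fintype.linearCombination ℕ fun j => L' (Pi.single j 1)) := by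
    funext m
    rw [Fintype.linearCombination_apply, LinearMap.pi_apply_eq_sum_univ L' m]
    refine Finset.sum_congr rfl fun j _ => ?_
    have : (fun k => if j = k then 1 else 0 : Fin s → ℕ) = Pi.single j 1 := by
      funext k
      simp [Pi.single_apply, eq_comm]
    rw [this]
  refine ⟨s, a, fun j => L' (Pi.single j 1), ?_, ?_⟩
  · rw [linearIndependent_natCast_iff_injective, ← hL']
    refine hL.comp (LinearMap.funLeft_injective_of_surjective ℕ ℕ _ eqv.surjective)
  · ext n
    simp only [Set.mem_range, Set.mem_ofPred_eq, ← Fintype.linearCombination_apply, ← hL']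
    constructor
    · rintro ⟨m, rfl⟩
      refine ⟨m ∘ eqv.symm, ?_⟩
      have : LinearMap.funLeft ℕ ℕ eqv (m ∘ eqv.symm) = m := by
        funext k
        simp
      simp [L', this]
    · rintro ⟨m, rfl⟩
      exact ⟨_, rfl⟩

theorem IsSimpleLinear.exists_range {d : ℕ} {S : Set (Fin d → ℕ)} (hS : IsSimpleLinear S) :
    ∃ (s : ℕ) (a : Fin d → ℕ) (L : (Fin s → ℕ) →ₗ[ℕ] (Fin d → ℕ)), Injective L ∧
      S = Set.range fun m => a + L m := by
  obtain ⟨s, a, b, hb, rfl⟩ := hS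
  refine ⟨s, a, Fintype.linearCombination ℕ b,
    (linearIndependent_natCast_iff_injective b).1 hb, ?_⟩
  ext n
  simp [Fintype.linearCombination_apply, eq_comm]

/-- `X` is a finite disjoint union of simple linear sets with property `Q`. -/
def Decomposable {d : ℕ} (X : Set (Fin d → ℕ)) (Q : Set (Fin d → ℕ) → Prop) : Prop :=
  ∃ (τ : Type) (_ : Finite τ) (S : τ → Set (Fin d → ℕ)), (∀ t, IsSimpleLinear (S t) ∧ Q (S t)) ∧
    Pairwise (fun i j => Disjoint (S i) (S j)) ∧ ⋃ t, S t = X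

namespace Decomposable

variable {d : ℕ} {X : Set (Fin d → ℕ)} {Q Q' : Set (Fin d → ℕ) → Prop}

theorem of_isSimpleLinear (h : IsSimpleLinear X) (hQ : Q X) : Decomposable X Q :=
  ⟨Unit, inferInstance, fun _ => X, fun _ => ⟨h, hQ⟩, fun _ _ hij => (hij rfl).elim,
    Set.iUnion_const X⟩

theorem iUnion {τ : Type} [Finite τ] (Y : τ → Set (Fin d → ℕ))
    (hY : Pairwise fun i j => Disjoint (Y i) (Y j)) (h : ∀ t, Decomposable (Y t) Q) :
    Decomposable (⋃ t, Y t) Q := by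
  choose σ hσ S hS hd hu using h
  refine ⟨Σ t, σ t, inferInstance, fun x => S x.1 x.2, fun x => hS x.1 x.2, ?_, ?_⟩
  · rintro ⟨t, x⟩ ⟨t', x'⟩ hne
    by_cases htt : t = t'
    · subst htt
      exact hd t fun h => hne (congrArg (Sigma.mk t) h)
    · refine (hY htt).mono ?_ ?_
      · rw [← hu]; exact Set.subset_iUnion (S t) x
      · rw [← hu]; exact Set.subset_iUnion (S t') x'
  · rw [Set.iUnion_sigma]
    exact Set.iUnion_congr hu

theorem bind (h : Decomposable X Q)
    (h' : ∀ S, IsSimpleLinear S → Q S → Decomposable S Q') : Decomposable X Q' := by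
  obtain ⟨τ, _, S, hS, hd, rfl⟩ := h
  exact iUnion S hd fun t => h' _ (hS t).1 (hS t).2

theorem of_fibers {τ : Type} [Finite τ] (κ : (Fin d → ℕ) → τ)
    (h : ∀ t, Decomposable (κ ⁻¹' {t}) Q) : Decomposable Set.univ Q := by
  have := iUnion (fun t => κ ⁻¹' {t}) (fun i j hij => ?_) h
  · convert this
    ext n
    simp
  · exact Disjoint.preimage κ (by simpa using hij)

theorem image {s : ℕ} {X : Set (Fin s → ℕ)} {Q : Set (Fin d → ℕ) → Prop} (a : Fin d → ℕ)
    (L : (Fin s → ℕ) →ₗ[ℕ] (Fin d → ℕ)) (hL : Injective L)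
    (h : Decomposable X fun S => Q ((fun m => a + L m) '' S)) :
    Decomposable ((fun m => a + L m) '' X) Q := by
  have hinj : Injective fun m => a + L m := fun m m' h => hL (add_left_cancel h)
  obtain ⟨τ, _, S, hS, hd, rfl⟩ := h
  refine ⟨τ, inferInstance, fun t => (fun m => a + L m) '' S t, fun t => ⟨?_, (hS t).2⟩,
    fun i j hij => (Set.disjoint_image_iff hinj).2 (hd hij), by rw [Set.image_iUnion]⟩
  obtain ⟨r, a', L', hL', h⟩ := (hS t).1.exists_range
  dsimp only
  rw [h, ← Set.range_comp]
  convert isSimpleLinear_range (a + L a') (L ∘ₗ L') (hL.comp hL') using 2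
  funext m
  simp [add_assoc]

theorem range {s : ℕ} {Q : Set (Fin d → ℕ) → Prop} (a : Fin d → ℕ)
    (L : (Fin s → ℕ) →ₗ[ℕ] (Fin d → ℕ)) (hL : Injective L)
    (h : Decomposable Set.univ fun S => Q ((fun m => a + L m) '' S)) :
    Decomposable (Set.range fun m => a + L m) Q := by
  rw [← Set.image_univ]
  exact image a L hL h

theorem mono (h : Decomposable X Q) (hQ : ∀ S, Q S → Q' S) : Decomposable X Q' := by
  obtain ⟨τ, i, S, hS, h⟩ := h
  exact ⟨τ, i, S, fun t => ⟨(hS t).1, hQ _ (hS t).2⟩, h⟩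

end Decomposable

/-! ### Functions constant on the pieces of a decomposition, stably under affine pullback -/

/-- `f` is constant on `S`. -/
def ConstOn {α β : Type*} (f : α → β) (S : Set α) : Prop :=
  ∀ x ∈ S, ∀ y ∈ S, f x = f y

/-- For every affine map `ℕ^s → ℕ^d`, the space `ℕ^s` is a finite disjoint union of simple linear
sets on which the pullback of `f` is constant. -/
def Refinable {d : ℕ} {β : Type*} (f : (Fin d → ℕ) → β) : Prop :=
  ∀ (s : ℕ) (a : Fin d → ℕ) (L : (Fin s → ℕ) →ₗ[ℕ] (Fin d → ℕ)),
    Decomposable Set.univ (ConstOn fun m => f (a + L m))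

namespace Refinable

variable {d : ℕ} {β γ : Type*} {f : (Fin d → ℕ) → β} {g : (Fin d → ℕ) → γ}

theorem comp (h : Refinable f) (u : β → γ) : Refinable fun n => u (f n) := fun s a L =>
  (h s a L).mono fun _ hS x hx y hy => congrArg u (hS x hx y hy)

/-- Each piece on which `f` is constant is parametrised by some `ℕ^r`; the property of `g`, applied
to the composite affine map, refines it further. This is why all affine maps are quantified over. -/
theorem prodMk (hf : Refinable f) (hg : Refinable g) : Refinable fun n => (f n, g n) := by
  intro s a L
  refine (hf s a L).bind fun S hS hc => ?_
  obtain ⟨r, a', L', hL', rfl⟩ := hS.exists_range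
  refine Decomposable.range a' L' hL' ((hg r (a + L a') (L ∘ₗ L')).mono fun S hS => ?_)
  rintro _ ⟨x, hx, rfl⟩ _ ⟨y, hy, rfl⟩
  refine Prod.ext (hc _ ⟨x, rfl⟩ _ ⟨y, rfl⟩) ?_
  have := hS x hx y hy
  simpa [add_assoc] using this

theorem const (c : β) : Refinable fun _ : Fin d → ℕ => c := fun s _ _ =>
  .of_isSimpleLinear (by
    have h := isSimpleLinear_range (0 : Fin s → ℕ) LinearMap.id injective_id
    convert h
    ext n
    simp) fun _ _ _ _ => rfl

theorem pi {ι : Type*} [Finite ι] {β : ι → Type*} {f : ∀ t, (Fin d → ℕ) → β t}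
    (hf : ∀ t, Refinable (f t)) : Refinable fun n t => f t n := by
  classical
  have := Fintype.ofFinite ι
  suffices h : ∀ T : Finset ι, Refinable fun n (t : T) => f t n by
    exact (h Finset.univ).comp fun v t => v ⟨t, Finset.mem_univ t⟩
  intro T
  induction T using Finset.induction_on with
  | empty =>
    intro s a L
    exact (const (d := d) () s a L).mono fun S _ x _ y _ =>
      funext fun t => absurd t.2 (Finset.notMem_empty _)
  | insert i T hi ih =>
    intro s a L
    refine ((hf i).prodMk ih s a L).mono fun S hS x hx y hy => ?_
    have := Prod.ext_iff.1 (hS x hx y hy)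
    funext ⟨t, ht⟩
    by_cases h : t = i
    · subst h
      exact this.1
    · exact congrFun this.2 ⟨t, (Finset.mem_insert.1 ht).resolve_left h⟩

end Refinable

/-! ### Decomposition along congruences and linear inequalities -/

theorem decomposable_constOn_mod (d M : ℕ) (hM : 0 < M) :
    Decomposable (Set.univ : Set (Fin d → ℕ)) (ConstOn fun n i => n i % M) := by
  refine .of_fibers (τ := Fin d → Fin M) (fun n i => ⟨n i % M, Nat.mod_lt _ hM⟩) fun v => ?_
  refine .of_isSimpleLinear ?_ ?_
  · convert isSimpleLinear_range (fun i => (v i : ℕ)) (M • LinearMap.id) ?_ using 1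
    · ext n
      simp only [Set.mem_preimage, Set.mem_singleton_iff, Set.mem_range, funext_iff, Fin.ext_iff]
      constructor
      · intro h
        exact ⟨fun i => n i / M, fun i => by simpa [← h i] using Nat.mod_add_div _ _⟩
      · rintro ⟨m, h⟩ i
        rw [← h]
        simp [Nat.mod_eq_of_lt]
    · intro m m' h
      funext i
      have := congrFun h i
      simpa [hM.ne'] using this
  · intro x hx y hy
    funext i
    have h1 := congrFun hx i
    have h2 := congrFun hy i
    simpa [Fin.ext_iff] using h1.trans h2.symm

/-- On a fibre, the coordinates truncated to a value below `c` are fixed, and the others range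
freely over integers at least `c`: a translate of a coordinate orthant. -/
theorem decomposable_constOn_min (d c : ℕ) :
    Decomposable (Set.univ : Set (Fin d → ℕ)) (ConstOn fun n i => min (n i) c) := by
  classical
  refine .of_fibers (τ := Fin d → Fin (c + 1)) (fun n i => ⟨min (n i) c, by omega⟩) fun v => ?_
  refine .of_isSimpleLinear ?_ ?_
  · let L : ({i // (v i : ℕ) = c} → ℕ) →ₗ[ℕ] (Fin d → ℕ) :=
      { toFun := fun w i => if h : (v i : ℕ) = c then w ⟨i, h⟩ else 0
        map_add' := fun w w' => by
          funext i; dsimp only [Pi.add_apply]; split_ifs <;> rfl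
        map_smul' := fun k w => by
          funext i; simp only [Pi.smul_apply, RingHom.id_apply]; split_ifs <;> simp }
    convert isSimpleLinear_range (fun i => (v i : ℕ)) L ?_ using 1
    · ext n
      simp only [Set.mem_preimage, Set.mem_singleton_iff, Set.mem_range, funext_iff, Fin.ext_iff]
      constructor
      · intro h
        refine ⟨fun i => n i - c, fun i => ?_⟩
        have := h i
        simp only [Pi.add_apply, L, LinearMap.coe_mk, AddHom.coe_mk]
        split_ifs <;> omega
      · rintro ⟨m, h⟩ i
        rw [← h]
        have := (v i).2
        simp only [Pi.add_apply, L, LinearMap.coe_mk, AddHom.coe_mk]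
        split_ifs <;> omega
    · intro m m' h
      funext ⟨i, hi⟩
      have := congrFun h i
      simpa [L, hi] using this
  · intro x hx y hy
    funext i
    have h1 := congrFun hx i
    have h2 := congrFun hy i
    simpa [Fin.ext_iff] using h1.trans h2.symm

/-- If a coordinate with positive coefficient exceeds `c`, its truncated term alone already reaches
`c`; otherwise truncation changes no term with non-zero coefficient. -/
theorem le_sum_mul_iff_le_sum_mul_min {d : ℕ} (p : Fin d → ℤ) (hp : ∀ i, 0 ≤ p i) (c : ℤ)
    (n : Fin d → ℕ) :
    c ≤ ∑ i, p i * n i ↔ c ≤ ∑ i, p i * (min (n i) c.toNat : ℕ) := by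
  constructor
  · intro h
    by_cases hi : ∃ i, 0 < p i ∧ c.toNat < n i
    · obtain ⟨i, hpi, hni⟩ := hi
      calc c ≤ p i * (min (n i) c.toNat : ℕ) := by
            rw [min_eq_right hni.le]
            nlinarith [Int.self_le_toNat c, (Int.natCast_nonneg c.toNat)]
        _ ≤ _ := Finset.single_le_sum (f := fun i => p i * (min (n i) c.toNat : ℕ))
            (fun j _ => mul_nonneg (hp j) (Int.natCast_nonneg _)) (Finset.mem_univ i)
    · push Not at hi
      convert h using 1
      refine Finset.sum_congr rfl fun i _ => ?_
      rcases (hp i).eq_or_lt with h0 | h0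
      · simp [← h0]
      · rw [min_eq_left (hi i h0)]
  · intro h
    refine h.trans (Finset.sum_le_sum fun i _ => mul_le_mul_of_nonneg_left ?_ (hp i))
    exact_mod_cast min_le_left _ _

theorem decomposable_constOn_le_of_nonneg {d : ℕ} (p : Fin d → ℤ) (hp : ∀ i, 0 ≤ p i) (c : ℤ) :
    Decomposable (Set.univ : Set (Fin d → ℕ)) (ConstOn fun n => c ≤ ∑ i, p i * n i) := by
  refine (decomposable_constOn_min d c.toNat).mono fun S hS x hx y hy => ?_
  have := hS x hx y hy
  dsimp only
  rw [le_sum_mul_iff_le_sum_mul_min p hp c x, le_sum_mul_iff_le_sum_mul_min p hp c y]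
  refine congrArg (c ≤ ·) (Finset.sum_congr rfl fun i _ => ?_)
  have h : min (x i) c.toNat = min (y i) c.toNat := congrFun this i
  rw [h]

theorem decomposable_constOn_le_of_nonpos {d : ℕ} (p : Fin d → ℤ) (hp : ∀ i, p i ≤ 0) (c : ℤ) :
    Decomposable (Set.univ : Set (Fin d → ℕ)) (ConstOn fun n => c ≤ ∑ i, p i * n i) := by
  refine (decomposable_constOn_le_of_nonneg (fun i => - p i)
    (fun i => neg_nonneg.2 (hp i)) (1 - c)).mono fun S hS x hx y hy => ?_
  have := hS x hx y hy
  simp only [neg_mul, Finset.sum_neg_distrib, eq_iff_iff] at this ⊢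
  omega

theorem exists_linearMap_of_add {d : ℕ} (L : (Fin d → ℕ) → Fin d → ℕ)
    (h : ∀ m m', L (m + m') = L m + L m') :
    ∃ L' : (Fin d → ℕ) →ₗ[ℕ] (Fin d → ℕ), ∀ m, L' m = L m :=
  ⟨{ toFun := L
     map_add' := h
     map_smul' := fun k m => by
      have h0 : L 0 = 0 := by simpa using h 0 0
      induction k with
      | zero => simp [h0]
      | succ k ih => rw [add_smul, h, ih, one_smul, RingHom.id_apply, RingHom.id_apply, add_smul,
          one_smul] },
    fun _ => rfl⟩

theorem sum_eq_add_add_sum_compl {ι M : Type*} [Fintype ι] [DecidableEq ι] [AddCommMonoid M]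
    (f : ι → M) {i j : ι} (hij : i ≠ j) :
    ∑ k, f k = f i + f j + ∑ k ∈ Finset.univ \ {i, j}, f k := by
  rw [← Finset.sum_sdiff (Finset.subset_univ {i, j}), Finset.sum_pair hij, add_comm]

/-- A Euclidean-type elimination, by induction on the number of non-zero coefficients. Given `p i =
P > 0` and `p j = -Q < 0`, write `n i = r + Q u` and `n j = r' + P v`. The two terms contribute a
constant plus `PQ (u - v)`, so once it is known which of `u`, `v` is larger, the difference and the
smaller one serve as new coordinates, and the smaller one has coefficient zero. -/
theorem decomposable_constOn_le {d : ℕ} (p : Fin d → ℤ) (c : ℤ) :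
    Decomposable (Set.univ : Set (Fin d → ℕ)) (ConstOn fun n => c ≤ ∑ i, p i * n i) := by
  induction hk : (Finset.univ.filter fun i => p i ≠ 0).card using Nat.strong_induction_on
    generalizing p c with
  | _ k ih =>
  subst hk
  by_cases hp : ∀ i, 0 ≤ p i
  · exact decomposable_constOn_le_of_nonneg p hp c
  by_cases hp' : ∀ i, p i ≤ 0
  · exact decomposable_constOn_le_of_nonpos p hp' c
  push Not at hp hp'
  obtain ⟨j, hj⟩ := hp
  obtain ⟨i, hi⟩ := hp'
  have hij : i ≠ j := by rintro rfl; omega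
  obtain ⟨P, hP⟩ := Int.eq_ofNat_of_zero_le hi.le
  obtain ⟨Q, hQ⟩ := Int.eq_ofNat_of_zero_le (neg_nonneg.2 hj.le)
  have hQ' : p j = -Q := by omega
  have hP0 : 0 < P := by omega
  have hQ0 : 0 < Q := by omega
  have hsupp : ∀ (q : Fin d → ℤ) (t : Fin d), q t = 0 → p t ≠ 0 → (∀ k, p k = 0 → q k = 0) →
      (Finset.univ.filter fun i => q i ≠ 0).card < (Finset.univ.filter fun i => p i ≠ 0).card := by
    intro q t hqt hpt h
    refine Finset.card_lt_card ⟨fun k hk => ?_, fun hs => ?_⟩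
    · simp only [Finset.mem_filter_univ] at hk ⊢
      exact fun h0 => hk (h k h0)
    · have := hs (x := t) (by simpa using hpt)
      simp [hqt] at this
  refine .of_fibers (τ := Bool × Fin Q × Fin P)
    (fun n => (decide (n j / P ≤ n i / Q), ⟨n i % Q, Nat.mod_lt _ hQ0⟩,
      ⟨n j % P, Nat.mod_lt _ hP0⟩)) ?_
  rintro ⟨β, r, r'⟩
  cases β with
  | true =>
    -- Case `v ≤ u`: the new coordinates are `m j = v` and `m i = u - v`.
    obtain ⟨L, hL⟩ := exists_linearMap_of_add
      (fun m k => if k = i then Q * (m i + m j) else if k = j then P * m j else m k)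
      (fun m m' => by
        funext k; simp only [Pi.add_apply]; split_ifs <;> ring)
    let a : Fin d → ℕ := fun k => if k = i then r else if k = j then r' else 0
    have hLinj : Injective L := by
      intro m m' h
      rw [hL, hL] at h
      have h1 := congrFun h i
      have h2 := congrFun h j
      simp only [if_true, hij.symm, if_false, mul_eq_mul_left_iff, hQ0.ne', hP0.ne', or_false]
        at h1 h2
      funext k
      by_cases hki : k = i
      · subst hki; omega
      by_cases hkj : k = j
      · subst hkj; omega
      simpa [hki, hkj] using congrFun h k
    have hsum : ∀ m, ∑ k, p k * ((a + L m) k : ℕ) =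
        (∑ k, (if k = i then (P * Q : ℤ) else if k = j then 0 else p k) * m k) +
          (P * r - Q * r') := by
      intro m
      rw [sum_eq_add_add_sum_compl _ hij, sum_eq_add_add_sum_compl _ hij]
      have : ∑ k ∈ Finset.univ \ {i, j}, p k * ((a + L m) k : ℕ) = ∑ k ∈ Finset.univ \ {i, j},
          (if k = i then (P * Q : ℤ) else if k = j then 0 else p k) * m k := by
        refine Finset.sum_congr rfl fun k hk => ?_
        simp only [Finset.mem_sdiff, Finset.mem_univ, Finset.mem_insert, Finset.mem_singleton,
          not_or, true_and] at hk
        simp [hL, a, hk.1, hk.2]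
      rw [this]
      simp only [Pi.add_apply, hL, a, if_true, hij.symm, if_false, hP, hQ']
      push_cast
      ring
    convert Decomposable.range (Q := ConstOn fun n => c ≤ ∑ i, p i * n i) a L hLinj ?_ using 1
    · ext n
      simp only [Set.mem_preimage, Set.mem_singleton_iff, Prod.mk.injEq, decide_eq_true_eq,
        Fin.ext_iff, Set.mem_range]
      constructor
      · rintro ⟨h1, h2, h3⟩
        refine ⟨fun k => if k = i then n i / Q - n j / P else if k = j then n j / P else n k, ?_⟩
        funext k
        simp only [Pi.add_apply, hL, a, if_true, hij.symm, if_false]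
        split_ifs with h h'
        · subst h
          rw [Nat.sub_add_cancel h1, ← h2, Nat.mod_add_div]
        · subst h'
          rw [← h3, Nat.mod_add_div]
        · simp
      · rintro ⟨m, rfl⟩
        simp [hL, a, hij.symm, Nat.add_mul_div_left, hP0, hQ0, Nat.mod_eq_of_lt, Nat.div_eq_of_lt]
    · refine (ih _ (hsupp (fun k => if k = i then (P * Q : ℤ) else if k = j then 0 else p k) j
        (by simp [hij.symm]) hj.ne ?_) _ (c - (P * r - Q * r')) rfl).mono fun S hS => ?_
      · intro k hk
        have : k ≠ i := by rintro rfl; omega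
        simp [this, hk]
      · rintro _ ⟨x, hx, rfl⟩ _ ⟨y, hy, rfl⟩
        have := hS x hx y hy
        simp only [hsum]
        simpa only [sub_le_iff_le_add] using this
  | false =>
    obtain ⟨L, hL⟩ := exists_linearMap_of_add
      (fun m k => if k = i then Q * m i else if k = j then P * (m i + m j) else m k)
      (fun m m' => by
        funext k; simp only [Pi.add_apply]; split_ifs <;> ring)
    -- Case `u < v`: here `m i = u` and `m j = v - u - 1`; the extra `P` accounts for the strict
    -- inequality and keeps the two cases disjoint.
    let a : Fin d → ℕ := fun k => if k = i then r else if k = j then r' + P else 0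
    have hLinj : Injective L := by
      intro m m' h
      rw [hL, hL] at h
      have h1 := congrFun h i
      have h2 := congrFun h j
      simp only [if_true, hij.symm, if_false, mul_eq_mul_left_iff, hQ0.ne', hP0.ne', or_false]
        at h1 h2
      funext k
      by_cases hki : k = i
      · subst hki; omega
      by_cases hkj : k = j
      · subst hkj; omega
      simpa [hki, hkj] using congrFun h k
    have hsum : ∀ m, ∑ k, p k * ((a + L m) k : ℕ) =
        (∑ k, (if k = i then 0 else if k = j then -(P * Q : ℤ) else p k) * m k) +
          (P * r - Q * r' - Q * P) := by
      intro m
      rw [sum_eq_add_add_sum_compl _ hij, sum_eq_add_add_sum_compl _ hij]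
      have : ∑ k ∈ Finset.univ \ {i, j}, p k * ((a + L m) k : ℕ) = ∑ k ∈ Finset.univ \ {i, j},
          (if k = i then 0 else if k = j then -(P * Q : ℤ) else p k) * m k := by
        refine Finset.sum_congr rfl fun k hk => ?_
        simp only [Finset.mem_sdiff, Finset.mem_univ, Finset.mem_insert, Finset.mem_singleton,
          not_or, true_and] at hk
        simp [hL, a, hk.1, hk.2]
      rw [this]
      simp only [Pi.add_apply, hL, a, if_true, hij.symm, if_false, hP, hQ']
      push_cast
      ring
    convert Decomposable.range (Q := ConstOn fun n => c ≤ ∑ i, p i * n i) a L hLinj ?_ using 1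
    · ext n
      simp only [Set.mem_preimage, Set.mem_singleton_iff, Prod.mk.injEq, decide_eq_false_iff_not,
        Fin.ext_iff, Set.mem_range, not_le]
      constructor
      · rintro ⟨h1, h2, h3⟩
        refine ⟨fun k => if k = i then n i / Q else if k = j then n j / P - n i / Q - 1 else n k,
          ?_⟩
        funext k
        simp only [Pi.add_apply, hL, a, if_true, hij.symm, if_false]
        split_ifs with h h'
        · subst h
          rw [← h2, Nat.mod_add_div]
        · subst h'
          rw [← h3, add_assoc, ← mul_one_add]
          have : 1 + (n i / Q + (n k / P - n i / Q - 1)) = n k / P := by omega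
          rw [this, Nat.mod_add_div]
        · simp
      · rintro ⟨m, rfl⟩
        have h1 : (r' : ℕ) + P + P * (m i + m j) = r' + P * (1 + m i + m j) := by ring
        simp [hL, a, hij.symm, h1, Nat.add_mul_div_left, hP0, hQ0, Nat.mod_eq_of_lt,
          Nat.div_eq_of_lt]
        omega
    · refine (ih _ (hsupp (fun k => if k = i then 0 else if k = j then -(P * Q : ℤ) else p k) i
        (by simp) hi.ne' ?_) _ (c - (P * r - Q * r' - Q * P)) rfl).mono fun S hS => ?_
      · intro k hk
        have : k ≠ j := by rintro rfl; omega
        simp [this, hk]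
      · rintro _ ⟨x, hx, rfl⟩ _ ⟨y, hy, rfl⟩
        have := hS x hx y hy
        simp only [hsum]
        simpa only [sub_le_iff_le_add] using this

theorem exists_sum_mul_affine {s d : ℕ} (p : Fin d → ℤ) (a : Fin d → ℕ)
    (L : (Fin s → ℕ) →ₗ[ℕ] (Fin d → ℕ)) :
    ∃ (q : Fin s → ℤ) (e : ℤ), ∀ m, ∑ i, p i * ((a + L m) i : ℕ) = ∑ j, q j * m j + e := by
  refine ⟨fun j => ∑ i, p i * (L (fun k => if j = k then 1 else 0) i : ℕ), ∑ i, p i * a i,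
    fun m => ?_⟩
  rw [LinearMap.pi_apply_eq_sum_univ L m]
  simp only [Pi.add_apply, Finset.sum_apply, Pi.smul_apply, smul_eq_mul, Nat.cast_add,
    Nat.cast_sum, Nat.cast_mul, mul_add, Finset.sum_add_distrib, Finset.sum_mul, Finset.mul_sum]
  rw [add_comm, Finset.sum_comm]
  congr 1
  exact Finset.sum_congr rfl fun _ _ => Finset.sum_congr rfl fun _ _ => by ring

theorem refinable_le {d : ℕ} (p : Fin d → ℤ) (c : ℤ) :
    Refinable fun n : Fin d → ℕ => c ≤ ∑ i, p i * n i := by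
  intro s a L
  obtain ⟨q, e, h⟩ := exists_sum_mul_affine p a L
  refine (decomposable_constOn_le q (c - e)).mono fun S hS x hx y hy => ?_
  have := hS x hx y hy
  simp only [h]
  simpa only [sub_le_iff_le_add] using this

theorem refinable_dvd {d : ℕ} (p : Fin d → ℤ) (c : ℤ) {M : ℕ} (hM : 0 < M) :
    Refinable fun n : Fin d → ℕ => (M : ℤ) ∣ (∑ i, p i * n i) - c := by
  intro s a L
  obtain ⟨q, e, h⟩ := exists_sum_mul_affine p a L
  refine (decomposable_constOn_mod s M hM).mono fun S hS x hx y hy => ?_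
  have := hS x hx y hy
  simp only [h]
  have hxy : (M : ℤ) ∣ ∑ j, q j * x j - ∑ j, q j * y j := by
    rw [← Finset.sum_sub_distrib]
    refine Finset.dvd_sum fun j _ => ?_
    rw [← mul_sub]
    refine Dvd.dvd.mul_left ?_ _
    exact (Nat.modEq_iff_dvd.1 (congrFun this j).symm)
  rw [eq_iff_iff]
  refine (dvd_iff_dvd_of_dvd_sub ?_)
  have h : ∀ A B : ℤ, A + e - c - (B + e - c) = A - B := fun A B => by ring
  rwa [h]

theorem refinable_eq {d : ℕ} (p : Fin d → ℤ) (c : ℤ) :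
    Refinable fun n : Fin d → ℕ => ∑ i, p i * n i = c := by
  have h := ((refinable_le p c).prodMk (refinable_le p (c + 1))).comp fun v => v.1 ∧ ¬ v.2
  convert h using 2 with n
  simp only
  omega

/-! ### Integral dual forms, and membership in a simple linear set as linear conditions -/

/-- Clearing denominators passes independence from `ℤ` to `ℚ`, where a left inverse exists; clearing
its denominators gives integral forms that read off the coordinates up to the factor `D`. -/
theorem exists_int_dual {ι : Type*} [Fintype ι] [DecidableEq ι] {d : ℕ} (b : ι → Fin d → ℕ)
    (hb : LinearIndependent ℤ (fun (j : ι) (i : Fin d) => (b j i : ℤ))) :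
    ∃ (D : ℕ) (ψ : ι → Fin d → ℤ), 0 < D ∧
      ∀ i j, ∑ k, ψ i k * (b j k : ℤ) = if i = j then (D : ℤ) else 0 := by
  have hbQ : LinearIndependent ℚ (fun (j : ι) (i : Fin d) => (b j i : ℚ)) := by
    rw [Fintype.linearIndependent_iff] at hb ⊢
    intro g hg i
    obtain ⟨⟨N, hN⟩, hN'⟩ := IsLocalization.exist_integer_multiples_of_finite
      (nonZeroDivisors ℤ) g
    choose z hz using hN'
    have hz' : ∀ j, (z j : ℚ) = N * g j := fun j => by simpa [Submonoid.smul_def] using hz j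
    have hN0 : (N : ℚ) ≠ 0 := by exact_mod_cast nonZeroDivisors.ne_zero hN
    have := hb z (by
      funext k
      have h := congrFun hg k
      simp only [Finset.sum_apply, Pi.smul_apply, smul_eq_mul, Pi.zero_apply] at h ⊢
      have h2 : (∑ j, (z j : ℚ) * b j k) = 0 := by
        simp_rw [hz', mul_assoc, ← Finset.mul_sum, h, mul_zero]
      exact_mod_cast h2) i
    have h3 := hz' i
    rw [this, Int.cast_zero, eq_comm, mul_eq_zero] at h3
    exact h3.resolve_left hN0
  obtain ⟨g, hg⟩ := LinearMap.exists_leftInverse_of_injective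
    (Fintype.linearCombination ℚ fun (j : ι) (i : Fin d) => (b j i : ℚ))
    (LinearMap.ker_eq_bot.2 hbQ.fintypeLinearCombination_injective)
  have hdual : ∀ i j, ∑ k, g (Pi.single k 1) i * (b j k : ℚ) = if i = j then 1 else 0 := by
    intro i j
    have h1 := congrFun (LinearMap.congr_fun hg (Pi.single j 1)) i
    simp only [LinearMap.comp_apply, Fintype.linearCombination_apply_single, one_smul,
      LinearMap.id_apply] at h1
    rw [LinearMap.pi_apply_eq_sum_univ g, Finset.sum_apply] at h1
    rw [Pi.single_apply] at h1
    rw [← h1]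
    refine Finset.sum_congr rfl fun k _ => ?_
    have : (fun j => if k = j then 1 else 0 : Fin d → ℚ) = Pi.single k 1 := by
      funext l
      simp [Pi.single_apply, eq_comm]
    rw [this, Pi.smul_apply, smul_eq_mul, mul_comm]
  obtain ⟨⟨N, hN⟩, hN'⟩ := IsLocalization.exist_integer_multiples_of_finite
    (nonZeroDivisors ℤ) (fun x : ι × Fin d => g (Pi.single x.2 1) x.1)
  choose z hz using hN'
  have hz' : ∀ i k, (z (i, k) : ℚ) = N * g (Pi.single k 1) i :=
    fun i k => by simpa [Submonoid.smul_def] using hz (i, k)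
  have hN0 : N ≠ 0 := nonZeroDivisors.ne_zero hN
  -- The common denominator `N` may be negative; the sign makes `D` positive.
  refine ⟨N.natAbs, fun i k => N.sign * z (i, k), Int.natAbs_pos.2 hN0, fun i j => ?_⟩
  have h1 : ∑ k, z (i, k) * (b j k : ℤ) = if i = j then N else 0 := by
    have : (∑ k, (z (i, k) : ℚ) * (b j k : ℚ)) = if i = j then (N : ℚ) else 0 := by
      simp_rw [hz', mul_assoc, ← Finset.mul_sum, hdual]
      simp
    exact_mod_cast this
  simp_rw [mul_assoc, ← Finset.mul_sum, h1]
  split_ifs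
  · rw [Int.sign_mul_self_eq_natAbs]
  · simp

theorem sum_dual_mul_affine {ι : Type*} [Fintype ι] [DecidableEq ι] {d : ℕ} (b : ι → Fin d → ℕ)
    {D : ℕ} {ψ : ι → Fin d → ℤ}
    (hψ : ∀ i j, ∑ k, ψ i k * (b j k : ℤ) = if i = j then (D : ℤ) else 0)
    (a : Fin d → ℕ) (m : ι → ℕ) (j : ι) :
    ∑ k, ψ j k * ((a + ∑ j, m j • b j) k : ℕ) = ∑ k, ψ j k * (a k : ℤ) + D * m j := by
  simp only [Pi.add_apply, Finset.sum_apply, Pi.smul_apply, smul_eq_mul, Nat.cast_add,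
    Nat.cast_sum, Nat.cast_mul, mul_add, Finset.sum_add_distrib, Finset.mul_sum]
  rw [Finset.sum_comm]
  congr 1
  have : ∀ l, ∑ k, ψ j k * ((m l : ℤ) * b l k) = m l * (if j = l then (D : ℤ) else 0) := by
    intro l
    rw [← hψ, Finset.mul_sum]
    exact Finset.sum_congr rfl fun _ _ => by ring
  simp_rw [this]
  simp [mul_comm]

theorem prod_zpow_eq_zpow_sum {ι G : Type*} [CommGroup G] (s : Finset ι) (x : G) (f : ι → ℤ) :
    ∏ i ∈ s, x ^ f i = x ^ ∑ i ∈ s, f i := by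
  classical
  induction s using Finset.induction_on with
  | empty => simp
  | insert i s hi ih => rw [Finset.prod_insert hi, Finset.sum_insert hi, zpow_add, ih]

/-- The inequalities and congruences on `ψ j` say that the would-be coordinates `m j = (ψ j · n - c
j) / D` are natural numbers; the equations say, multiplied by `D`, that `n = a + ∑ m j • b j`. -/
theorem IsSimpleLinear.refinable_mem {d : ℕ} {S : Set (Fin d → ℕ)} (hS : IsSimpleLinear S) :
    Refinable fun n => n ∈ S := by
  obtain ⟨s, a, b, hb, rfl⟩ := hS
  obtain ⟨D, ψ, hD, hψ⟩ := exists_int_dual b hb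
  let c : Fin s → ℤ := fun j => ∑ k, ψ j k * a k
  -- These are the components of `n ↦ D n - ∑ⱼ (ψ j · n) b j`, which kills every `b j`.
  let p : Fin d → Fin d → ℤ := fun i k => (if i = k then (D : ℤ) else 0) - ∑ j, ψ j k * b j i
  have hp : ∀ i (n : Fin d → ℕ), ∑ k, p i k * (n k : ℤ) =
      D * n i - ∑ j, (∑ k, ψ j k * n k) * b j i := by
    intro i n
    simp only [p, sub_mul, Finset.sum_sub_distrib, ite_mul, zero_mul, Finset.sum_ite_eq,
      Finset.mem_univ, if_true, Finset.sum_mul]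
    rw [Finset.sum_comm]
    congr 1
    exact Finset.sum_congr rfl fun _ _ => Finset.sum_congr rfl fun _ _ => by ring
  have h1 := Refinable.pi fun j => refinable_le (ψ j) (c j)
  have h2 := Refinable.pi fun j => refinable_dvd (ψ j) (c j) hD
  have h3 := Refinable.pi fun i => refinable_eq (p i) (D * a i - ∑ j, c j * b j i)
  convert (h1.prodMk (h2.prodMk h3)).comp fun v => (∀ j, v.1 j) ∧ (∀ j, v.2.1 j) ∧ ∀ j, v.2.2 j
    using 2 with n
  simp only [Set.mem_ofPred_eq, hp]
  constructor
  · rintro ⟨m, rfl⟩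
    have hm : ∀ j, ∑ k, ψ j k * ((a + ∑ j, m j • b j) k : ℕ) = c j + D * m j :=
      sum_dual_mul_affine b hψ a m
    simp only [hm]
    refine ⟨fun j => le_add_of_nonneg_right (by positivity), fun j => ⟨m j, by ring⟩, fun i => ?_⟩
    simp only [Pi.add_apply, Finset.sum_apply, Pi.smul_apply, smul_eq_mul, Nat.cast_add,
        Nat.cast_sum, Nat.cast_mul, mul_add, add_mul, Finset.sum_add_distrib, Finset.mul_sum,
        mul_assoc]
    ring
  · rintro ⟨h1, h2, h3⟩
    have : ∀ j, ∃ m : ℕ, ∑ k, ψ j k * (n k : ℤ) = c j + D * m := by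
      intro j
      obtain ⟨z, hz⟩ := h2 j
      have hz0 : 0 ≤ z := by
        by_contra hneg
        have := h1 j
        nlinarith [mul_neg_of_pos_of_neg (Int.natCast_pos.2 hD) (not_le.1 hneg)]
      obtain ⟨m, rfl⟩ := Int.eq_ofNat_of_zero_le hz0
      exact ⟨m, by linarith⟩
    choose m hm using this
    refine ⟨m, ?_⟩
    funext i
    have := h3 i
    simp only [hm, add_mul, Finset.sum_add_distrib, mul_assoc, ← Finset.mul_sum] at this
    have h4 : (D : ℤ) * n i = D * (a i + ∑ j, (m j : ℤ) * b j i) := by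
      linarith
    have h5 := mul_left_cancel₀ (by exact_mod_cast hD.ne') h4
    simp only [Pi.add_apply, Finset.sum_apply, Pi.smul_apply, smul_eq_mul]
    exact_mod_cast h5

/-! ### Polynomial-exponential functions on a fixed set -/

namespace IsPolyExpOn

variable {K : Type*} [Field K] {d : ℕ} {f g : (Fin d → ℕ) → K} {S T : Set (Fin d → ℕ)}

theorem mono (h : IsPolyExpOn f S) (hT : T ⊆ S) : IsPolyExpOn f T := by
  obtain ⟨k, A, α, h⟩ := h
  exact ⟨k, A, α, fun n hn => h n (hT hn)⟩

theorem congr (h : IsPolyExpOn f S) (hfg : ∀ n ∈ S, g n = f n) : IsPolyExpOn g S := by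
  obtain ⟨k, A, α, h⟩ := h
  exact ⟨k, A, α, fun n hn => (hfg n hn).trans (h n hn)⟩

theorem zero : IsPolyExpOn (fun _ => (0 : K)) S :=
  ⟨0, Fin.elim0, Fin.elim0, fun _ _ => by simp⟩

theorem add (hf : IsPolyExpOn f S) (hg : IsPolyExpOn g S) :
    IsPolyExpOn (fun n => f n + g n) S := by
  obtain ⟨k, A, α, hf⟩ := hf
  obtain ⟨l, B, β, hg⟩ := hg
  exact ⟨k + l, Fin.append A B, Fin.append α β, fun n hn => by
    simp [hf n hn, hg n hn, Fin.sum_univ_add]⟩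

theorem sum {ι : Type*} (s : Finset ι) {f : ι → (Fin d → ℕ) → K}
    (hf : ∀ i ∈ s, IsPolyExpOn (f i) S) : IsPolyExpOn (fun n => ∑ i ∈ s, f i n) S := by
  classical
  induction s using Finset.induction_on with
  | empty => simpa using zero
  | insert i s hi ih =>
    simp only [Finset.sum_insert hi]
    exact (hf i (Finset.mem_insert_self i s)).add
      (ih fun j hj => hf j (Finset.mem_insert_of_mem hj))

/-- A product of univariate polynomial-exponential functions of the coordinates of a simple
linear set is polynomial-exponential in the ambient coordinates. -/
theorem of_coordinates [CharZero K] [IsAlgClosed K] {ι : Type*} [Fintype ι] (a : Fin d → ℕ)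
    (b : ι → Fin d → ℕ) (hb : LinearIndependent ℤ (fun (j : ι) (i : Fin d) => (b j i : ℤ)))
    (c : ι → Kˣ) (q : Polynomial K) (γ : K)
    (hf : ∀ m : ι → ℕ, f (a + ∑ j, m j • b j) = γ * ∏ j, ((c j : K) ^ m j * q.eval (m j : K))) :
    IsPolyExpOn f (Set.range fun m : ι → ℕ => a + ∑ j, m j • b j) := by
  classical
  obtain ⟨D, ψ, hD, hψ⟩ := exists_int_dual b hb
  -- Since `D mⱼ = ψⱼ · n - eⱼ`, a `D`-th root `δⱼ` of `cⱼ` turns `cⱼ ^ mⱼ` into `δⱼ ^ (ψⱼ · n -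
  -- eⱼ)`, an exponential in `n` up to a constant. Algebraic closedness is used here.
  have hroot : ∀ j, ∃ δ : Kˣ, δ ^ D = c j := by
    intro j
    obtain ⟨z, hz⟩ := IsAlgClosed.exists_pow_nat_eq (c j : K) hD
    have hz0 : z ≠ 0 := by
      rintro rfl
      rw [zero_pow hD.ne'] at hz
      exact (c j).ne_zero hz.symm
    exact ⟨Units.mk0 z hz0, Units.ext (by simpa using hz)⟩
  choose δ hδ using hroot
  let e : ι → ℤ := fun j => ∑ k, ψ j k * a k
  let u : Kˣ := ∏ j, δ j ^ e j
  have hDK : (D : K) ≠ 0 := by exact_mod_cast hD.ne'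
  have hm : ∀ (m : ι → ℕ) j, ∑ k, ψ j k * ((a + ∑ j, m j • b j) k : ℕ) = e j + D * m j :=
    fun m => sum_dual_mul_affine b hψ a m
  -- The polynomial in `n` that takes the value `mⱼ` on the set; characteristic zero allows division
  -- by `D`.
  let t : ι → MvPolynomial (Fin d) K := fun j =>
    MvPolynomial.C (D : K)⁻¹ * (∑ k, MvPolynomial.C (ψ j k : K) * MvPolynomial.X k -
      MvPolynomial.C (e j : K))
  refine ⟨1, fun _ => MvPolynomial.C (γ * ((u⁻¹ : Kˣ) : K)) * ∏ j, Polynomial.aeval (t j) q,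
    fun _ k => ∏ j, δ j ^ ψ j k, ?_⟩
  rintro _ ⟨m, rfl⟩
  dsimp only
  rw [hf, Fin.sum_univ_one]
  have hexp : (∏ k, (∏ j, δ j ^ ψ j k) ^ ((a + ∑ j, m j • b j) k)) = u * ∏ j, c j ^ m j := by
    simp only [← Finset.prod_pow]
    rw [Finset.prod_comm, ← Finset.prod_mul_distrib]
    refine Finset.prod_congr rfl fun j _ => ?_
    rw [← hδ j, ← pow_mul, ← zpow_natCast (δ j) (D * m j), ← zpow_add, Nat.cast_mul, ← hm m j,
      ← prod_zpow_eq_zpow_sum]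
    exact Finset.prod_congr rfl fun k _ => by rw [zpow_mul, zpow_natCast]
  have hexp' : (∏ k, ((∏ j, δ j ^ ψ j k : Kˣ) : K) ^ ((a + ∑ j, m j • b j) k)) =
      u * ∏ j, (c j : K) ^ m j := by
    have := congrArg (Units.val) hexp
    simpa using this
  have ht : ∀ j, MvPolynomial.eval (fun i => ((a + ∑ j, m j • b j) i : K)) (t j) = m j := by
    intro j
    have := congrArg (Int.cast (R := K)) (hm m j)
    push_cast at this
    simp only [t, map_mul, map_sub, map_sum, MvPolynomial.eval_C, MvPolynomial.eval_X]
    rw [inv_mul_eq_iff_eq_mul₀ hDK, sub_eq_iff_eq_add, add_comm (_ * _)]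
    exact_mod_cast this
  have hq : ∀ j, MvPolynomial.eval (fun i => ((a + ∑ j, m j • b j) i : K))
      (Polynomial.aeval (t j) q) = q.eval (m j : K) := by
    intro j
    rw [← ht j, Polynomial.aeval_def, Polynomial.hom_eval₂, Polynomial.eval]
    congr 1
    ext x
    simp [MvPolynomial.algebraMap_eq]
  rw [hexp']
  simp only [map_mul, map_prod, MvPolynomial.eval_C, hq, Finset.prod_mul_distrib]
  have : ((u⁻¹ : Kˣ) : K) * u = 1 := by simp
  linear_combination (-γ * (∏ j, (c j : K) ^ m j) * ∏ j, q.eval (m j : K)) * this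

end IsPolyExpOn

/-! ### Expansion of inverse products with independent exponents -/

/-- The power series with coefficient sequence `f`. -/
def seqSeries {K : Type*} {d : ℕ} (f : (Fin d → ℕ) → K) : MvPowerSeries (Fin d) K :=
  fun n => f n

section

variable {K : Type*} [Field K] {d : ℕ}

theorem coeff_seqSeries (f : (Fin d → ℕ) → K) (n : Fin d →₀ ℕ) :
    MvPowerSeries.coeff n (seqSeries f) = f n := rfl

theorem seqSeries_coeffSeq (F : MvPowerSeries (Fin d) K) : seqSeries (coeffSeq F) = F := by
  ext n
  rw [coeff_seqSeries, coeffSeq, Finsupp.equivFunOnFinite_symm_coe]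

/-- As `L` is injective, series supported on its image multiply as in the independent variables `yⱼ
= x^(L eⱼ)`: the factor `1 - c yᵢ` replaces `w m` by `w m - c w (m - eᵢ)`, where the second term is
absent if `m i = 0`. -/
theorem one_sub_monomial_mul_seqSeries_extend {ι : Type*} [Fintype ι] [DecidableEq ι]
    (L : (ι → ℕ) →ₗ[ℕ] (Fin d → ℕ)) (hL : Injective L) (i : ι) (c : K)
    (w w' : (ι → ℕ) → K) (h0 : ∀ m, m i = 0 → w' m = w m)
    (h1 : ∀ m, w' (m + Pi.single i 1) = w (m + Pi.single i 1) - c * w m) :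
    (1 - MvPowerSeries.monomial (Finsupp.equivFunOnFinite.symm (L (Pi.single i 1))) c) *
      seqSeries (extend L w 0) = seqSeries (extend L w' 0) := by
  classical
  ext n
  rw [sub_mul, one_mul, map_sub, MvPowerSeries.coeff_monomial_mul, coeff_seqSeries,
    coeff_seqSeries, coeff_seqSeries]
  have hle : Finsupp.equivFunOnFinite.symm (L (Pi.single i 1)) ≤ n ↔ L (Pi.single i 1) ≤ n := by
    rfl
  have hsub : ((n - Finsupp.equivFunOnFinite.symm (L (Pi.single i 1)) : Fin d →₀ ℕ) : Fin d → ℕ)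
      = n - L (Pi.single i 1) := by
    ext; simp
  rw [hsub]
  simp only [hle]
  generalize (n : Fin d → ℕ) = n
  by_cases hn : ∃ m, L m = n
  · obtain ⟨m, rfl⟩ := hn
    rw [hL.extend_apply, hL.extend_apply]
    rcases Nat.eq_zero_or_pos (m i) with hm | hm
    · rw [h0 m hm]
      split_ifs with h
      · rw [extend_apply', Pi.zero_apply, mul_zero, sub_zero]
        rintro ⟨m', hm'⟩
        have : L (m' + Pi.single i 1) = L m := by
          rw [map_add, hm', tsub_add_cancel_of_le h]
        have := congrFun (hL this) i
        simp [hm] at this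
      · rw [sub_zero]
    · obtain ⟨m', rfl⟩ : ∃ m', m = m' + Pi.single i 1 := by
        refine ⟨m - Pi.single i 1, (tsub_add_cancel_of_le fun j => ?_).symm⟩
        by_cases hj : j = i
        · subst hj; simpa [Nat.one_le_iff_ne_zero, Nat.pos_iff_ne_zero] using hm
        · simp [hj]
      rw [map_add, if_pos le_add_self, add_tsub_cancel_right, hL.extend_apply, h1]
  · rw [extend_apply' _ _ _ hn, extend_apply' _ _ _ hn, Pi.zero_apply]
    split_ifs with h
    · rw [extend_apply', Pi.zero_apply, mul_zero, sub_zero]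
      rintro ⟨m', hm'⟩
      exact hn ⟨m' + Pi.single i 1, by rw [map_add, hm', tsub_add_cancel_of_le h]⟩
    · rw [sub_zero]

/-- The coefficients of `∏ (1 - cⱼ yⱼ)^(-kⱼ)`. -/
def negBinomialCoeff {ι : Type*} [Fintype ι] (c : ι → K) (k m : ι → ℕ) : K :=
  ∏ j, c j ^ m j * (Nat.multichoose (k j) (m j) : K)

/-- Induction on the total exponent: one factor lowers `k i` by one, by the Pascal rule
`Nat.multichoose_succ_succ`. For `k = 0` the coefficients are those of the series `1`. -/
theorem prod_one_sub_monomial_pow_mul_seqSeries_extend {ι : Type*} [Fintype ι] [DecidableEq ι]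
    (L : (ι → ℕ) →ₗ[ℕ] (Fin d → ℕ)) (hL : Injective L) (c : ι → K) (k : ι → ℕ) :
    (∏ j, (1 - MvPowerSeries.monomial
      (Finsupp.equivFunOnFinite.symm (L (Pi.single j 1))) (c j)) ^ k j) *
        seqSeries (extend L (negBinomialCoeff c k) 0) = 1 := by
  induction hN : ∑ j, k j generalizing k with
  | zero =>
    have hk : k = 0 := by
      funext j
      exact Finset.sum_eq_zero_iff.1 hN j (Finset.mem_univ j)
    subst hk
    simp only [Pi.zero_apply, pow_zero, Finset.prod_const_one, one_mul]
    ext n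
    rw [coeff_seqSeries, MvPowerSeries.coeff_one]
    by_cases hn : ∃ m, L m = n
    · obtain ⟨m, hm⟩ := hn
      rw [← hm, hL.extend_apply, negBinomialCoeff]
      split_ifs with h
      · have : m = 0 := hL (by rw [hm, h, map_zero]; rfl)
        simp [this]
      · have : m ≠ 0 := by
          rintro rfl
          rw [map_zero] at hm
          exact h (DFunLike.coe_injective hm.symm)
        obtain ⟨j, hj⟩ := Function.ne_iff.1 this
        refine Finset.prod_eq_zero (Finset.mem_univ j) ?_
        obtain ⟨l, hl⟩ := Nat.exists_eq_succ_of_ne_zero hj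
        simp [hl]
    · rw [extend_apply' _ _ _ hn, if_neg, Pi.zero_apply]
      rintro rfl
      exact hn ⟨0, by rw [map_zero]; rfl⟩
  | succ N ih =>
    obtain ⟨i, hi⟩ : ∃ i, k i ≠ 0 := by
      by_contra! h
      simp [h] at hN
    obtain ⟨l, hl⟩ := Nat.exists_eq_succ_of_ne_zero hi
    let k' := update k i l
    have hk'i : k' i = l := update_self ..
    have hk'j : ∀ j ∈ Finset.univ.erase i, k' j = k j := fun j hj =>
      update_of_ne (Finset.ne_of_mem_erase hj) ..
    have hstep := one_sub_monomial_mul_seqSeries_extend L hL i (c i) (negBinomialCoeff c k)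
      (negBinomialCoeff c k') (fun m hm => by
        simp only [negBinomialCoeff]
        rw [← Finset.mul_prod_erase _ _ (Finset.mem_univ i),
          ← Finset.mul_prod_erase (a := i) _ _ (Finset.mem_univ i), hm]
        congr 1
        · simp
        · exact Finset.prod_congr rfl fun j hj => by rw [hk'j j hj]) (fun m => by
        have hrest : ∀ κ : ι → ℕ, (∀ j ∈ Finset.univ.erase i, κ j = k j) →
            ∀ m' : ι → ℕ, (∀ j ∈ Finset.univ.erase i, m' j = m j) →
            negBinomialCoeff c κ m' = c i ^ m' i * (Nat.multichoose (κ i) (m' i) : K) *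
              ∏ j ∈ Finset.univ.erase i, c j ^ m j * (Nat.multichoose (k j) (m j) : K) := by
          intro κ hκ m' hm'
          rw [negBinomialCoeff, ← Finset.mul_prod_erase _ _ (Finset.mem_univ i)]
          congr 1
          exact Finset.prod_congr rfl fun j hj => by rw [hκ j hj, hm' j hj]
        have hm' : ∀ j ∈ Finset.univ.erase i, (m + Pi.single i 1 : ι → ℕ) j = m j := fun j hj => by
          simp [Finset.ne_of_mem_erase hj]
        rw [hrest k' hk'j _ hm', hrest k (fun _ _ => rfl) _ hm',
          hrest k (fun _ _ => rfl) m (fun _ _ => rfl), hk'i, hl]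
        simp only [Pi.add_apply, Pi.single_eq_same, Nat.succ_eq_add_one,
          Nat.multichoose_succ_succ]
        push_cast
        ring)
    have hsum : ∑ j, k' j = N := by
      rw [← Finset.add_sum_erase _ _ (Finset.mem_univ i)] at hN ⊢
      have : ∑ j ∈ Finset.univ.erase i, k' j = ∑ j ∈ Finset.univ.erase i, k j :=
        Finset.sum_congr rfl hk'j
      rw [hk'i, this]
      omega
    have := ih k' hsum
    rw [← hstep, ← mul_assoc] at this
    refine Eq.trans ?_ this
    congr 1
    rw [← Finset.mul_prod_erase _ _ (Finset.mem_univ i),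
      ← Finset.mul_prod_erase (a := i) _ _ (Finset.mem_univ i), hl, hk'i, pow_succ]
    have hrest : ∏ j ∈ Finset.univ.erase i, (1 - MvPowerSeries.monomial
        (Finsupp.equivFunOnFinite.symm (L (Pi.single j 1))) (c j)) ^ k' j =
        ∏ j ∈ Finset.univ.erase i, (1 - MvPowerSeries.monomial
        (Finsupp.equivFunOnFinite.symm (L (Pi.single j 1))) (c j)) ^ k j :=
      Finset.prod_congr rfl fun j hj => by rw [hk'j j hj]
    rw [hrest]
    ring

end

/-! ### From piecewise polynomial-exponential sequences to rational series -/

section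

variable {K : Type*} [Field K] {d : ℕ}

/-- The subring of polynomials in the ring of power series. -/
noncomputable def polySubring (K : Type*) [Field K] (d : ℕ) : Subring (MvPowerSeries (Fin d) K) :=
  (MvPolynomial.coeToMvPowerSeries.ringHom (σ := Fin d) (R := K)).range

/-- The multiplicative monoid generated by the factors `1 - c u`, for `c ∈ K^*` and non-constant
monomials `u`. -/
noncomputable def geometricSubmonoid (K : Type*) [Field K] (d : ℕ) :
    Submonoid (MvPowerSeries (Fin d) K) :=
  Submonoid.closure
    {V | ∃ (c : Kˣ) (e : Fin d →₀ ℕ), e ≠ 0 ∧ V = 1 - MvPowerSeries.monomial e (c : K)}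

theorem monomial_mem_polySubring (e : Fin d →₀ ℕ) (c : K) :
    MvPowerSeries.monomial e c ∈ polySubring K d :=
  ⟨MvPolynomial.monomial e c, by simp⟩

theorem one_sub_monomial_mem_geometricSubmonoid {e : Fin d →₀ ℕ} (he : e ≠ 0) {c : K}
    (hc : c ≠ 0) : 1 - MvPowerSeries.monomial e c ∈ geometricSubmonoid K d :=
  Submonoid.subset_closure ⟨Units.mk0 c hc, e, he, rfl⟩

theorem geometricSubmonoid_le_polySubring :
    geometricSubmonoid K d ≤ (polySubring K d).toSubmonoid := by
  rw [geometricSubmonoid, Submonoid.closure_le]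
  rintro _ ⟨c, e, -, rfl⟩
  exact (polySubring K d).sub_mem (polySubring K d).one_mem (monomial_mem_polySubring _ _)

theorem constantCoeff_one_sub_monomial {e : Fin d →₀ ℕ} (he : e ≠ 0) (c : K) :
    MvPowerSeries.constantCoeff (1 - MvPowerSeries.monomial e c) = 1 := by
  classical
  rw [map_sub, map_one, ← MvPowerSeries.coeff_zero_eq_constantCoeff_apply,
    MvPowerSeries.coeff_monomial_ne he.symm, sub_zero]

/-- `F` is a quotient of a polynomial by a product of factors `1 - c u`. -/
def IsGeometricRational (F : MvPowerSeries (Fin d) K) : Prop :=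
  ∃ D ∈ geometricSubmonoid K d, D * F ∈ polySubring K d

/-- The denominator has constant coefficient `1`, so the inverse can be cleared. -/
theorem hasGeometricDenominator_iff_exists_prod_mul (F : MvPowerSeries (Fin d) K) :
    HasGeometricDenominator F ↔ ∃ (l : ℕ) (c : Fin l → Kˣ) (e : Fin l → Fin d →₀ ℕ),
      (∀ i, e i ≠ 0) ∧ (∏ i, (1 - MvPowerSeries.monomial (e i) (c i : K))) * F ∈
        polySubring K d := by
  have key : ∀ (l : ℕ) (c : Fin l → Kˣ) (e : Fin l → Fin d →₀ ℕ),
      ((∏ i, (1 - MvPolynomial.C (c i : K) * MvPolynomial.monomial (e i) 1) :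
          MvPolynomial (Fin d) K) : MvPowerSeries (Fin d) K) =
        ∏ i, (1 - MvPowerSeries.monomial (e i) (c i : K)) := by
    intro l c e
    rw [← MvPolynomial.coeToMvPowerSeries.ringHom_apply, map_prod]
    refine Finset.prod_congr rfl fun i _ => ?_
    rw [MvPolynomial.C_mul_monomial, mul_one, map_sub, map_one,
      MvPolynomial.coeToMvPowerSeries.ringHom_apply, MvPolynomial.coe_monomial]
  have key0 : ∀ (l : ℕ) (c : Fin l → Kˣ) (e : Fin l → Fin d →₀ ℕ), (∀ i, e i ≠ 0) →
      MvPowerSeries.constantCoeff (∏ i, (1 - MvPowerSeries.monomial (e i) (c i : K))) ≠ 0 := by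
    intro l c e he
    rw [map_prod, Finset.prod_congr rfl fun i _ => constantCoeff_one_sub_monomial (he i) (c i : K)]
    simp
  constructor
  · rintro ⟨P, l, c, e, he, h⟩
    refine ⟨l, c, e, he, P, ?_⟩
    rw [key, MvPowerSeries.eq_mul_inv_iff_mul_eq (key0 l c e he), mul_comm] at h
    exact h.symm
  · rintro ⟨l, c, e, he, P, hP⟩
    refine ⟨P, l, c, e, he, ?_⟩
    rw [key, MvPowerSeries.eq_mul_inv_iff_mul_eq (key0 l c e he), mul_comm]
    exact hP.symm

theorem IsGeometricRational.hasGeometricDenominator {F : MvPowerSeries (Fin d) K}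
    (h : IsGeometricRational F) : HasGeometricDenominator F := by
  obtain ⟨D, hD, h⟩ := h
  rw [hasGeometricDenominator_iff_exists_prod_mul]
  obtain ⟨L, hL, rfl⟩ := Submonoid.exists_list_of_mem_closure hD
  choose c e he hV using fun i : Fin L.length => hL _ (L.get_mem i)
  refine ⟨L.length, c, e, he, ?_⟩
  rw [← List.prod_ofFn]
  convert h using 3
  conv_rhs => rw [← List.ofFn_get L]
  congr 1
  funext i
  exact (hV i).symm

namespace IsGeometricRational

variable {F G : MvPowerSeries (Fin d) K}

theorem of_mem (h : F ∈ polySubring K d) : IsGeometricRational F :=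
  ⟨1, one_mem _, by rwa [one_mul]⟩

theorem add (hF : IsGeometricRational F) (hG : IsGeometricRational G) :
    IsGeometricRational (F + G) := by
  obtain ⟨D, hD, hF⟩ := hF
  obtain ⟨E, hE, hG⟩ := hG
  refine ⟨D * E, mul_mem hD hE, ?_⟩
  have : D * E * (F + G) = E * (D * F) + D * (E * G) := by ring
  rw [this]
  exact add_mem (mul_mem (geometricSubmonoid_le_polySubring hE) hF)
    (mul_mem (geometricSubmonoid_le_polySubring hD) hG)

theorem sum {ι : Type*} (s : Finset ι) {F : ι → MvPowerSeries (Fin d) K}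
    (h : ∀ i ∈ s, IsGeometricRational (F i)) : IsGeometricRational (∑ i ∈ s, F i) := by
  classical
  induction s using Finset.induction_on with
  | empty => simpa using of_mem (zero_mem _)
  | insert i s hi ih =>
    rw [Finset.sum_insert hi]
    exact (h i (Finset.mem_insert_self i s)).add
      (ih fun j hj => h j (Finset.mem_insert_of_mem hj))

theorem mul (hF : IsGeometricRational F) (hG : IsGeometricRational G) :
    IsGeometricRational (F * G) := by
  obtain ⟨D, hD, hF⟩ := hF
  obtain ⟨E, hE, hG⟩ := hG
  refine ⟨D * E, mul_mem hD hE, ?_⟩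
  rw [mul_mul_mul_comm]
  exact mul_mem hF hG

end IsGeometricRational

/-- The Euler operator `xᵢ ∂/∂xᵢ`. -/
noncomputable def eulerOp (i : Fin d) (F : MvPowerSeries (Fin d) K) : MvPowerSeries (Fin d) K :=
  MvPowerSeries.X i * MvPowerSeries.pderiv K i F

theorem eulerOp_mul (i : Fin d) (F G : MvPowerSeries (Fin d) K) :
    eulerOp i (F * G) = F * eulerOp i G + eulerOp i F * G := by
  simp only [eulerOp, Derivation.leibniz, smul_eq_mul]
  ring

theorem eulerOp_mem_polySubring (i : Fin d) {F : MvPowerSeries (Fin d) K}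
    (hF : F ∈ polySubring K d) : eulerOp i F ∈ polySubring K d := by
  obtain ⟨p, rfl⟩ := hF
  refine ⟨MvPolynomial.X i * MvPolynomial.pderiv i p, ?_⟩
  simp [eulerOp, MvPowerSeries.pderiv_coe]

theorem eulerOp_seqSeries (i : Fin d) (f : (Fin d → ℕ) → K) :
    eulerOp i (seqSeries f) = seqSeries fun n => (n i : K) * f n := by
  classical
  ext n
  rw [eulerOp, MvPowerSeries.X, MvPowerSeries.coeff_monomial_mul, coeff_seqSeries]
  split_ifs with h
  · rw [MvPowerSeries.coeff_pderiv, tsub_add_cancel_of_le h, coeff_seqSeries, one_mul]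
    have : 1 ≤ n i := by simpa using h i
    rw [mul_comm]
    congr 1
    rw [← Nat.cast_add_one]
    congr 1
    simp only [Finsupp.coe_tsub, Pi.sub_apply, Finsupp.single_eq_same]
    omega
  · have : n i = 0 := by
      by_contra h0
      exact h (Finsupp.single_le_iff.2 (by omega))
    rw [this]
    simp

/-- The quotient rule: `D² θF = D θ(DF) - θ(D) (DF)`, with polynomial right-hand side. -/
theorem IsGeometricRational.eulerOp {F : MvPowerSeries (Fin d) K} (hF : IsGeometricRational F)
    (i : Fin d) : IsGeometricRational (eulerOp i F) := by
  obtain ⟨D, hD, hF⟩ := hF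
  refine ⟨D * D, mul_mem hD hD, ?_⟩
  have : D * D * _root_.eulerOp i F =
      D * _root_.eulerOp i (D * F) - _root_.eulerOp i D * (D * F) := by
    rw [eulerOp_mul]
    ring
  rw [this]
  have hD' := geometricSubmonoid_le_polySubring hD
  exact sub_mem (mul_mem hD' (eulerOp_mem_polySubring i hF))
    (mul_mem (eulerOp_mem_polySubring i hD') hF)

theorem rescale_mem_polySubring (α : Fin d → K) {F : MvPowerSeries (Fin d) K}
    (hF : F ∈ polySubring K d) : MvPowerSeries.rescale α F ∈ polySubring K d := by
  obtain ⟨p, rfl⟩ := hF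
  rw [MvPolynomial.coeToMvPowerSeries.ringHom_apply]
  have hmon : ∀ e c, MvPowerSeries.rescale α (MvPowerSeries.monomial e c) ∈ polySubring K d := by
    classical
    intro e c
    convert monomial_mem_polySubring e ((e.prod fun s m => α s ^ m) * c) using 1
    ext n
    rw [MvPowerSeries.coeff_rescale, MvPowerSeries.coeff_monomial, MvPowerSeries.coeff_monomial]
    split_ifs with h
    · rw [h]
    · rw [mul_zero]
  induction p using MvPolynomial.induction_on' with
  | monomial e c => rw [MvPolynomial.coe_monomial]; exact hmon e c
  | add p q hp hq =>
    rw [MvPolynomial.coe_add, map_add]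
    exact add_mem hp hq

theorem rescale_mem_geometricSubmonoid (α : Fin d → Kˣ) {D : MvPowerSeries (Fin d) K}
    (hD : D ∈ geometricSubmonoid K d) :
    MvPowerSeries.rescale (fun i => (α i : K)) D ∈ geometricSubmonoid K d := by
  classical
  induction hD using Submonoid.closure_induction with
  | mem V hV =>
    obtain ⟨c, e, he, rfl⟩ := hV
    have : MvPowerSeries.rescale (fun i => (α i : K))
        (1 - MvPowerSeries.monomial e (c : K)) =
        1 - MvPowerSeries.monomial e ((e.prod fun s m => (α s : K) ^ m) * c) := by
      rw [map_sub, map_one]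
      congr 1
      ext n
      rw [MvPowerSeries.coeff_rescale, MvPowerSeries.coeff_monomial, MvPowerSeries.coeff_monomial]
      split_ifs with h
      · rw [h]
      · rw [mul_zero]
    rw [this]
    refine one_sub_monomial_mem_geometricSubmonoid he (mul_ne_zero ?_ c.ne_zero)
    exact Finset.prod_ne_zero_iff.2 fun i _ => pow_ne_zero _ (α i).ne_zero
  | one => rw [map_one]; exact one_mem _
  | mul x y _ _ hx hy => rw [map_mul]; exact mul_mem hx hy

theorem IsGeometricRational.rescale {F : MvPowerSeries (Fin d) K} (hF : IsGeometricRational F)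
    (α : Fin d → Kˣ) :
    IsGeometricRational (MvPowerSeries.rescale (fun i => (α i : K)) F) := by
  obtain ⟨D, hD, hF⟩ := hF
  refine ⟨_, rescale_mem_geometricSubmonoid α hD, ?_⟩
  rw [← map_mul]
  exact rescale_mem_polySubring _ hF

theorem rescale_seqSeries (α : Fin d → K) (f : (Fin d → ℕ) → K) :
    MvPowerSeries.rescale α (seqSeries f) = seqSeries fun n => (∏ i, α i ^ n i) * f n := by
  ext n
  rw [MvPowerSeries.coeff_rescale, coeff_seqSeries, coeff_seqSeries]
  congr 1
  exact Finsupp.prod_fintype _ _ fun _ => pow_zero _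

theorem seqSeries_sum {ι : Type*} (s : Finset ι) (f : ι → (Fin d → ℕ) → K) :
    seqSeries (fun n => ∑ i ∈ s, f i n) = ∑ i ∈ s, seqSeries (f i) := by
  ext n
  simp [coeff_seqSeries]

/-- Multiplying the coefficients by the coordinate `n i` is the Euler operator, so induction on `A`
applies. -/
theorem IsGeometricRational.eval_mul {f : (Fin d → ℕ) → K}
    (hf : IsGeometricRational (seqSeries f)) (A : MvPolynomial (Fin d) K) :
    IsGeometricRational
      (seqSeries fun n => MvPolynomial.eval (fun i => (n i : K)) A * f n) := by
  induction A using MvPolynomial.induction_on with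
  | C c =>
    have : (seqSeries fun n => MvPolynomial.eval (fun i => (n i : K)) (MvPolynomial.C c) * f n) =
        MvPowerSeries.monomial 0 c * seqSeries f := by
      ext n
      simp [coeff_seqSeries]
    rw [this]
    exact (of_mem (monomial_mem_polySubring 0 c)).mul hf
  | add p q hp hq =>
    simp only [map_add, add_mul]
    exact hp.add hq
  | mul_X p i hp =>
    simp only [map_mul, MvPolynomial.eval_X]
    have := hp.eulerOp i
    rw [eulerOp_seqSeries] at this
    convert this using 3 with n
    ring

/-- The series is `x^a ∏ (1 - x^(bⱼ))⁻¹`: the expansion above with all `cⱼ` and all exponents equal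
to `1` has every coefficient on the image equal to `1`. -/
theorem IsSimpleLinear.isGeometricRational_indicator {S : Set (Fin d → ℕ)}
    (hS : IsSimpleLinear S) :
    IsGeometricRational (seqSeries (S.indicator (1 : (Fin d → ℕ) → K))) := by
  classical
  obtain ⟨s, a, L, hL, rfl⟩ := hS.exists_range
  have h := prod_one_sub_monomial_pow_mul_seqSeries_extend L hL (fun _ => (1 : K)) (fun _ => 1)
  have hne : ∀ j, Finsupp.equivFunOnFinite.symm (L (Pi.single j 1)) ≠ 0 := by
    intro j hj
    have h0 : L (Pi.single j 1) = L 0 := by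
      rw [map_zero]
      exact congrArg DFunLike.coe hj
    have := congrFun (hL h0) j
    simp at this
  have h1 : IsGeometricRational
      (seqSeries (extend L (negBinomialCoeff (fun _ => (1 : K)) (fun _ => 1)) 0)) := by
    refine ⟨_, ?_, h ▸ one_mem _⟩
    exact Submonoid.prod_mem _ fun j _ => Submonoid.pow_mem _
      (one_sub_monomial_mem_geometricSubmonoid (hne j) one_ne_zero) _
  convert (IsGeometricRational.of_mem
    (monomial_mem_polySubring (Finsupp.equivFunOnFinite.symm a) (1 : K))).mul h1 using 1
  ext n
  rw [MvPowerSeries.coeff_monomial_mul, coeff_seqSeries]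
  have hle : Finsupp.equivFunOnFinite.symm a ≤ n ↔ a ≤ n := by rfl
  simp only [hle, one_mul, coeff_seqSeries, Finsupp.coe_tsub, Finsupp.coe_equivFunOnFinite_symm]
  generalize (n : Fin d → ℕ) = n
  by_cases hn : n ∈ Set.range fun m => a + L m
  · rw [Set.indicator_of_mem hn]
    obtain ⟨m, rfl⟩ := hn
    simp [hL.extend_apply, negBinomialCoeff]
  · rw [Set.indicator_of_notMem hn]
    split_ifs with h
    · rw [extend_apply', Pi.zero_apply]
      rintro ⟨m, hm⟩
      exact hn ⟨m, by simp only [hm, add_tsub_cancel_of_le h]⟩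
    · rfl

theorem IsPiecewisePolyExp.isGeometricRational {f : (Fin d → ℕ) → K}
    (hf : IsPiecewisePolyExp f) : IsGeometricRational (seqSeries f) := by
  classical
  obtain ⟨m, S, hS, hd, hu, hf⟩ := hf
  choose k A α hf using hf
  have : f = fun n => ∑ i, ∑ j, MvPolynomial.eval (fun l => (n l : K)) (A i j) *
      ((∏ l, (α i j l : K) ^ n l) * (S i).indicator 1 n) := by
    funext n
    have hn : n ∈ ⋃ i, S i := by rw [hu]; trivial
    obtain ⟨i, hi⟩ := Set.mem_iUnion.1 hn
    rw [Finset.sum_eq_single i, hf i n hi]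
    · refine Finset.sum_congr rfl fun j _ => ?_
      rw [Set.indicator_of_mem hi, Pi.one_apply, mul_one]
    · intro i' _ hne
      refine Finset.sum_eq_zero fun j _ => ?_
      rw [Set.indicator_of_notMem (Set.disjoint_left.1 (hd hne.symm) hi), mul_zero, mul_zero]
    · simp
  rw [this, seqSeries_sum]
  refine .sum _ fun i _ => ?_
  rw [seqSeries_sum]
  refine .sum _ fun j _ => ?_
  refine .eval_mul ?_ _
  rw [← rescale_seqSeries]
  exact ((hS i).isGeometricRational_indicator).rescale _

end

/-! ### Partial fractions -/

section

variable {A B : Type*} [CommRing A] [CommRing B]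

/-- Some power of `v` is a denominator of `F` with respect to `φ : A → B`. -/
def HasPowDenominator (φ : A →+* B) (v : A) (F : B) : Prop :=
  ∃ (N : ℕ) (p : A), φ (v ^ N) * F = φ p

namespace HasPowDenominator

variable {φ : A →+* B} {v w : A} {F : B}

theorem of_dvd_pow (h : HasPowDenominator φ v F) {k : ℕ} (hvw : v ∣ w ^ k) :
    HasPowDenominator φ w F := by
  obtain ⟨N, p, h⟩ := h
  obtain ⟨a, ha⟩ := hvw
  refine ⟨k * N, a ^ N * p, ?_⟩
  rw [pow_mul, ha, map_mul, ← h, mul_pow, map_mul]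
  ring

theorem of_dvd (h : HasPowDenominator φ v F) (hvw : v ∣ w) : HasPowDenominator φ w F :=
  h.of_dvd_pow (k := 1) (by rwa [pow_one])

/-- The radical of the ideal generated by the `Vᵢ ^ N` contains every `Vᵢ`, hence `q`. -/
theorem exists_pow_mem_span_pow {ι : Type*} (V : ι → A) (I : Finset ι) {q : A}
    (hq : q ∈ Ideal.span (V '' I)) (N : ℕ) :
    ∃ (M : ℕ) (h : ι → A), q ^ M = ∑ i ∈ I, h i * V i ^ N := by
  have hle : Ideal.span (V '' I) ≤ (Ideal.span ((fun i => V i ^ N) '' I)).radical := by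
    rw [Ideal.span_le]
    rintro _ ⟨i, hi, rfl⟩
    exact ⟨N, Ideal.subset_span ⟨i, hi, rfl⟩⟩
  obtain ⟨M, hM⟩ := hle hq
  obtain ⟨h, hh⟩ := (Submodule.mem_span_image_finset_iff_exists_fun A).1 hM
  classical
  refine ⟨M, fun i => if hi : i ∈ I then h ⟨i, hi⟩ else 0, ?_⟩
  rw [← hh, ← Finset.sum_coe_sort I]
  exact Finset.sum_congr rfl fun i _ => by simp

/-- If `q` is in the ideal generated by factors `Vᵢ` of the denominator, the fraction is a sum of
fractions in which `q` replaces one of these factors. -/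
theorem exists_sum_eq {ι : Type*} [DecidableEq ι] (V : ι → A) {I S : Finset ι} (hI : I ⊆ S)
    {q : A} (hq : q ∈ Ideal.span (V '' I)) (hu : IsUnit (φ q))
    (h : HasPowDenominator φ (w * ∏ i ∈ S, V i) F) :
    ∃ G : ι → B, F = ∑ i ∈ I, G i ∧
      ∀ i ∈ I, HasPowDenominator φ (q * (w * ∏ k ∈ S.erase i, V k)) (G i) := by
  obtain ⟨N, p, h⟩ := h
  obtain ⟨M, g, hg⟩ := exists_pow_mem_span_pow V I hq N
  obtain ⟨u, hu⟩ := hu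
  -- From `q ^ M = ∑ gᵢ Vᵢ ^ N`, dividing by `q ^ M` splits `F` into the terms `q⁻ᴹ gᵢ Vᵢ ^ N F`, in
  -- which `Vᵢ ^ N` cancels that factor of the denominator.
  refine ⟨fun i => (u⁻¹ : Bˣ) ^ M * (φ (g i * V i ^ N) * F), ?_, fun i hi => ?_⟩
  · rw [← Finset.mul_sum, ← Finset.sum_mul, ← map_sum, ← hg, map_pow, ← hu, ← mul_assoc,
      ← mul_pow, Units.inv_mul, one_pow, one_mul]
  · refine ⟨M + N, q ^ N * (w * ∏ k ∈ S.erase i, V k) ^ M * g i * p, ?_⟩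
    have h1 : (w * ∏ i ∈ S, V i) ^ N = V i ^ N * (w * ∏ k ∈ S.erase i, V k) ^ N := by
      rw [← Finset.mul_prod_erase _ _ (hI hi)]
      ring
    have h2 : φ q ^ M * (u⁻¹ : Bˣ) ^ M = 1 := by
      rw [← hu, ← mul_pow, Units.mul_inv, one_pow]
    rw [map_mul φ _ p, ← h, h1]
    generalize w * ∏ k ∈ S.erase i, V k = z
    simp only [map_mul, map_pow]
    linear_combination (φ q ^ N * φ z ^ (M + N) * φ (g i) * φ (V i) ^ N * F) * h2

end HasPowDenominator

/-- Modulo the ideal every `X i` is `1`, hence so is the product. -/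
theorem one_sub_prod_mem_span {ι : Type*} (X : ι → A) (I : Finset ι) :
    1 - ∏ i ∈ I, X i ∈ Ideal.span ((fun i => 1 - X i) '' I) := by
  classical
  induction I using Finset.induction_on with
  | empty => simp
  | insert i I hi ih =>
    rw [Finset.prod_insert hi]
    have h : 1 - X i * ∏ j ∈ I, X j = (1 - X i) + X i * (1 - ∏ j ∈ I, X j) := by ring
    rw [h]
    refine Ideal.add_mem _ (Ideal.subset_span ⟨i, by simp, rfl⟩) (Ideal.mul_mem_left _ _ ?_)
    exact Ideal.span_mono (Set.image_mono (by simp)) ih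

end

section

variable {K : Type*} [Field K] {d : ℕ}

/-- The factor `1 - c x^e`. -/
noncomputable def geometricFactor (c : Kˣ) (e : Fin d →₀ ℕ) : MvPolynomial (Fin d) K :=
  1 - MvPolynomial.monomial e (c : K)

theorem coe_geometricFactor (c : Kˣ) (e : Fin d →₀ ℕ) :
    MvPolynomial.coeToMvPowerSeries.ringHom (geometricFactor c e) =
      1 - MvPowerSeries.monomial e (c : K) := by
  rw [geometricFactor, map_sub, map_one, MvPolynomial.coeToMvPowerSeries.ringHom_apply,
    MvPolynomial.coe_monomial]

theorem isUnit_coe_geometricFactor (c : Kˣ) {e : Fin d →₀ ℕ} (he : e ≠ 0) :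
    IsUnit (MvPolynomial.coeToMvPowerSeries.ringHom (geometricFactor c e)) := by
  rw [coe_geometricFactor, MvPowerSeries.isUnit_iff_constantCoeff,
    constantCoeff_one_sub_monomial he]
  exact isUnit_one

theorem geometricFactor_dvd_pow (c : Kˣ) (e : Fin d →₀ ℕ) (r : ℕ) :
    geometricFactor c e ∣ geometricFactor (c ^ r) (r • e) := by
  have : geometricFactor (c ^ r) (r • e) = 1 - (MvPolynomial.monomial e (c : K)) ^ r := by
    rw [geometricFactor, MvPolynomial.monomial_pow, Units.val_pow_eq_pow_val]
  rw [this, ← mul_neg_geom_sum]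
  exact Dvd.intro _ rfl

/-- Fractions whose denominator is a product of powers of factors `1 - cⱼ x^eⱼ` with linearly
independent exponent vectors `eⱼ`. -/
def independentFractions (K : Type*) [Field K] (d : ℕ) : Set (MvPowerSeries (Fin d) K) :=
  {G | ∃ (ι : Type) (_ : Fintype ι) (c : ι → Kˣ) (e : ι → Fin d →₀ ℕ),
    LinearIndependent ℤ (fun (j : ι) (i : Fin d) => (e j i : ℤ)) ∧
    HasPowDenominator MvPolynomial.coeToMvPowerSeries.ringHom
      (∏ j, geometricFactor (c j) (e j)) G}

/-- A linear relation between non-zero vectors of `ℕ^d`, scaled to the form `∑_I = ∑_J`. -/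
theorem exists_smul_sum_eq_sum {ι : Type*} [Fintype ι] (e : ι → Fin d →₀ ℕ) (he : ∀ i, e i ≠ 0)
    (h : ¬ LinearIndependent ℤ (fun (j : ι) (i : Fin d) => (e j i : ℤ))) :
    ∃ (r : ι → ℕ) (I J : Finset ι), (∀ i, r i ≠ 0) ∧ Disjoint I J ∧ I.Nonempty ∧ J.Nonempty ∧
      ∑ i ∈ I, r i • e i = ∑ j ∈ J, r j • e j := by
  classical
  rw [Fintype.not_linearIndependent_iff] at h
  obtain ⟨g, hg, i₀, hi₀⟩ := h
  -- The value `1` where `g` vanishes keeps every `r i • e i` non-zero; such indices lie in neither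
  -- `I` nor `J`.
  let r : ι → ℕ := fun i => if g i = 0 then 1 else (g i).natAbs
  have hr : ∀ i, r i ≠ 0 := fun i => by
    simp only [r]
    split_ifs <;> omega
  let I : Finset ι := Finset.univ.filter fun i => 0 < g i
  let J : Finset ι := Finset.univ.filter fun i => g i < 0
  have hsum : ∑ i ∈ I, r i • e i = ∑ j ∈ J, r j • e j := by
    ext k
    have hk := congrFun hg k
    simp only [Finset.sum_apply, Pi.smul_apply, smul_eq_mul, Pi.zero_apply] at hk
    simp only [Finsupp.coe_finsetSum, Finset.sum_apply, Finsupp.smul_apply, smul_eq_mul]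
    zify
    rw [← sub_eq_zero, ← hk]
    simp only [I, J, Finset.sum_filter]
    rw [← Finset.sum_sub_distrib]
    refine Finset.sum_congr rfl fun i _ => ?_
    rcases lt_trichotomy (g i) 0 with h | h | h
    · have : (r i : ℤ) = - g i := by simp only [r]; rw [if_neg h.ne]; omega
      rw [if_neg h.not_gt, if_pos h, this]
      ring
    · simp [h]
    · have : (r i : ℤ) = g i := by simp only [r]; rw [if_neg h.ne']; omega
      rw [if_pos h, if_neg h.not_gt, this]
      ring
  -- There is no cancellation in `ℕ^d`, so neither side of the relation can be empty unless both
  -- are.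
  have hempty : ∀ T : Finset ι, ∑ i ∈ T, r i • e i = 0 → T = ∅ := by
    intro T hT
    rw [Finset.eq_empty_iff_forall_notMem]
    intro i hi
    have := (Finset.sum_eq_zero_iff.1 hT) i hi
    rw [smul_eq_zero] at this
    exact this.elim (hr i) (he i)
  have hIJ : ¬ (I = ∅ ∧ J = ∅) := by
    rintro ⟨hI, hJ⟩
    rcases lt_or_gt_of_ne hi₀ with h | h
    · exact Finset.notMem_empty i₀ (hJ ▸ by simpa [J] using h)
    · exact Finset.notMem_empty i₀ (hI ▸ by simpa [I] using h)
  refine ⟨r, I, J, hr, ?_, ?_, ?_, hsum⟩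
  · rw [Finset.disjoint_left]
    intro i hi hj
    simp only [I, J, Finset.mem_filter_univ] at hi hj
    omega
  · rw [Finset.nonempty_iff_ne_empty]
    intro hI
    exact hIJ ⟨hI, hempty J (by rw [← hsum, hI, Finset.sum_empty])⟩
  · rw [Finset.nonempty_iff_ne_empty]
    intro hJ
    exact hIJ ⟨hempty I (by rw [hsum, hJ, Finset.sum_empty]), hJ⟩

/-- Partial fraction decomposition. -/
theorem mem_closure_independentFractions {ι : Type} [Fintype ι] (c : ι → Kˣ)
    (e : ι → Fin d →₀ ℕ) (he : ∀ i, e i ≠ 0) {F : MvPowerSeries (Fin d) K}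
    (hF : HasPowDenominator MvPolynomial.coeToMvPowerSeries.ringHom
      (∏ j, geometricFactor (c j) (e j)) F) :
    F ∈ AddSubmonoid.closure (independentFractions K d) := by
  classical
  induction hn : Fintype.card ι using Nat.strong_induction_on generalizing ι F with
  | _ n ih =>
  subst hn
  by_cases hind : LinearIndependent ℤ (fun (j : ι) (i : Fin d) => (e j i : ℤ))
  · exact AddSubmonoid.subset_closure ⟨ι, inferInstance, c, e, hind, hF⟩
  obtain ⟨r, I, J, hr, hIJ, hI, hJ, hsum⟩ := exists_smul_sum_eq_sum e he hind
  let V : ι → MvPolynomial (Fin d) K := fun i => geometricFactor (c i ^ r i) (r i • e i)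
  have he' : ∀ i, r i • e i ≠ 0 := fun i => smul_ne_zero (hr i) (he i)
  replace hF := hF.of_dvd (w := 1 * ∏ i, V i)
    (by rw [one_mul]; exact Finset.prod_dvd_prod_of_dvd _ _ fun i _ => geometricFactor_dvd_pow ..)
  let E : Fin d →₀ ℕ := ∑ i ∈ I, r i • e i
  have hE : E ≠ 0 := by
    intro h0
    obtain ⟨i, hi⟩ := hI
    exact he' i (Finset.sum_eq_zero_iff.1 h0 i hi)
  let γ : Finset ι → Kˣ := fun T => ∏ i ∈ T, c i ^ r i
  have hspan : ∀ T : Finset ι, ∑ i ∈ T, r i • e i = E →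
      geometricFactor (γ T) E ∈ Ideal.span (V '' T) := by
    intro T hT
    have := one_sub_prod_mem_span
      (fun i => MvPolynomial.monomial (r i • e i) ((c i ^ r i : Kˣ) : K)) T
    rw [← MvPolynomial.monomial_sum_prod, hT, ← Units.coe_prod] at this
    exact this
  -- If the constants agree, the same `q = 1 - γ x^E` lies in the ideals of `I` and of `J`. It
  -- replaces first a factor from `I`, then one from `J`: two factors leave and only one new one
  -- enters.
  by_cases hγ : γ I = γ J
  · obtain ⟨G, rfl, hG⟩ := hF.exists_sum_eq V (Finset.subset_univ I) (hspan I rfl)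
      (isUnit_coe_geometricFactor _ hE)
    refine AddSubmonoid.sum_mem _ fun i hi => ?_
    obtain ⟨H, hH', hH⟩ := (((hG i hi).of_dvd (w := geometricFactor (γ I) E *
      ∏ k ∈ Finset.univ.erase i, V k) (by rw [one_mul])).exists_sum_eq V (I := J)
      (fun j hj => Finset.mem_erase.2 ⟨fun h : j = i => Finset.disjoint_left.1 hIJ (h ▸ hi) hj,
        Finset.mem_univ j⟩) (hspan J hsum.symm) (isUnit_coe_geometricFactor _ hE))
    rw [hH']
    refine AddSubmonoid.sum_mem _ fun j hj => ?_
    have hij : j ≠ i := fun h => Finset.disjoint_left.1 hIJ (h ▸ hi) hj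
    let S := (Finset.univ.erase i).erase j
    refine ih (Fintype.card (Option S)) ?_
      (fun o => o.elim (γ I) fun k => c k ^ r k) (fun o => o.elim E fun k => r k • e k) ?_ ?_ rfl
    · rw [Fintype.card_option, Fintype.card_coe, Finset.card_erase_of_mem
        (Finset.mem_erase.2 ⟨hij, Finset.mem_univ j⟩), Finset.card_erase_of_mem
        (Finset.mem_univ i), Finset.card_univ]
      have : 1 < Fintype.card ι := Fintype.one_lt_card_iff.2 ⟨j, i, hij⟩
      omega
    · rintro (_ | k)
      · exact hE
      · exact he' k
    · rw [Fintype.prod_option]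
      -- After both replacements `q` occurs twice; the square of the new product absorbs this.
      refine (hH j hj).of_dvd_pow (k := 2) ?_
      rw [← hγ]
      refine ⟨∏ k ∈ S, V k, ?_⟩
      have : ∏ k : S, V k = ∏ k ∈ S, V k := Finset.prod_coe_sort S V
      simp only [Option.elim_none, Option.elim_some]
      change (_ * ∏ k : S, V k) ^ 2 = _
      rw [this]
      ring
  -- If the constants differ, `γ_J (1 - γ_I x^E) - γ_I (1 - γ_J x^E)` is a non-zero constant, so the
  -- factors from `I ∪ J` generate the unit ideal and one factor can be dropped from each term.
  · have h1 : (1 : MvPolynomial (Fin d) K) ∈ Ideal.span (V '' (I ∪ J : Finset ι)) := by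
      have hI' := Ideal.span_mono (Set.image_mono (f := V) (by simp)) (hspan I rfl)
        (t := V '' (I ∪ J : Finset ι))
      have hJ' := Ideal.span_mono (Set.image_mono (f := V) (by simp)) (hspan J hsum.symm)
        (t := V '' (I ∪ J : Finset ι))
      have hne : (γ J : K) - γ I ≠ 0 := sub_ne_zero.2 fun h => hγ (Units.ext h.symm)
      have : (1 : MvPolynomial (Fin d) K) = MvPolynomial.C ((γ J : K) - γ I)⁻¹ *
          (MvPolynomial.C (γ J : K) * geometricFactor (γ I) E -
            MvPolynomial.C (γ I : K) * geometricFactor (γ J) E) := by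
        simp only [geometricFactor, mul_sub, MvPolynomial.C_mul_monomial, mul_one]
        rw [mul_comm (γ J : K) (γ I : K), sub_sub_sub_cancel_right, ← mul_sub, ← map_sub,
          ← map_mul, inv_mul_cancel₀ hne, map_one]
      rw [this]
      exact Ideal.mul_mem_left _ _ (Ideal.sub_mem _ (Ideal.mul_mem_left _ _ hI')
        (Ideal.mul_mem_left _ _ hJ'))
    obtain ⟨G, rfl, hG⟩ := hF.exists_sum_eq V (Finset.subset_univ (I ∪ J)) h1
      (by rw [map_one]; exact isUnit_one)
    refine AddSubmonoid.sum_mem _ fun i hi => ?_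
    let S := Finset.univ.erase i
    refine ih (Fintype.card S) ?_ (fun k : S => c k ^ r k) (fun k => r k • e k)
      (fun k => he' k) ?_ rfl
    · rw [Fintype.card_coe]
      exact Finset.card_erase_lt_of_mem (Finset.mem_univ i)
    · refine (hG i hi).of_dvd ?_
      rw [one_mul, one_mul, ← Finset.prod_coe_sort S V]

end

/-! ### From independent fractions to piecewise polynomial-exponential sequences -/

/-- There is a refinable function on whose fibers `f` is polynomial-exponential. -/
def IsRefinedPolyExp {K : Type*} [Field K] {d : ℕ} (f : (Fin d → ℕ) → K) : Prop :=
  ∃ (β : Type) (g : (Fin d → ℕ) → β), Refinable g ∧ ∀ v, IsPolyExpOn f (g ⁻¹' {v})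

/-- The value is `(m + 1) ⋯ (m + M) / M!`, a polynomial in `m`. The exponent `M + 1` must be
positive: for exponent `0` the sequence is `1, 0, 0, …`. -/
theorem exists_eval_eq_multichoose (K : Type*) [Field K] [CharZero K] (M : ℕ) :
    ∃ q : Polynomial K, ∀ m : ℕ, q.eval (m : K) = (Nat.multichoose (M + 1) m : K) := by
  refine ⟨Polynomial.C (M.factorial : K)⁻¹ * (ascPochhammer K M).comp (Polynomial.X + 1),
    fun m => ?_⟩
  have h1 : (Nat.multichoose (M + 1) m) = (m + M).choose M := by
    rw [Nat.multichoose_eq, Nat.add_right_comm, Nat.add_sub_cancel, ← Nat.choose_symm_add,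
      add_comm]
  have h2 : (ascPochhammer K M).eval ((m : K) + 1) =
      (M.factorial : K) * ((m + M).choose M : K) := by
    rw [← Nat.cast_add_one, ← ascPochhammer_eval_cast, ascPochhammer_nat_eq_ascFactorial,
      Nat.ascFactorial_eq_factorial_mul_choose, Nat.cast_mul]
  have h3 : (M.factorial : K) ≠ 0 := by exact_mod_cast M.factorial_ne_zero
  rw [Polynomial.eval_mul, Polynomial.eval_C, Polynomial.eval_comp, Polynomial.eval_add,
    Polynomial.eval_X, Polynomial.eval_one, h2, h1, inv_mul_cancel_left₀ h3]

namespace IsRefinedPolyExp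

variable {K : Type*} [Field K] {d : ℕ} {f g : (Fin d → ℕ) → K}

theorem zero : IsRefinedPolyExp fun _ : Fin d → ℕ => (0 : K) :=
  ⟨Unit, fun _ => (), .const _, fun _ => .zero⟩

/-- Fibres of the paired function lie in fibres of both, so no explicit intersection of partitions
is needed. -/
theorem add (hf : IsRefinedPolyExp f) (hg : IsRefinedPolyExp g) :
    IsRefinedPolyExp fun n => f n + g n := by
  obtain ⟨β, u, hu, hf⟩ := hf
  obtain ⟨γ, v, hv, hg⟩ := hg
  refine ⟨β × γ, _, hu.prodMk hv, fun x => ((hf x.1).mono ?_).add ((hg x.2).mono ?_)⟩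
  · rintro n rfl; rfl
  · rintro n rfl; rfl

theorem of_isSimpleLinear {S : Set (Fin d → ℕ)} (hS : IsSimpleLinear S) (hf : IsPolyExpOn f S)
    (h0 : ∀ n ∉ S, f n = 0) : IsRefinedPolyExp f := by
  refine ⟨Prop, fun n => n ∈ S, hS.refinable_mem, fun v => ?_⟩
  by_cases hv : v
  · refine hf.mono fun n (hn : (n ∈ S) = v) => ?_
    rw [hn]
    exact hv
  · refine IsPolyExpOn.zero.congr fun n (hn : (n ∈ S) = v) => h0 n ?_
    rw [hn]
    exact hv

/-- The pullback along the identity yields a partition; each piece is non-empty and lies in a single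
fibre of the refinable function. -/
theorem isPiecewisePolyExp (hf : IsRefinedPolyExp f) : IsPiecewisePolyExp f := by
  obtain ⟨β, g, hg, hf⟩ := hf
  obtain ⟨τ, _, S, hS, hd, hu⟩ := hg d 0 LinearMap.id
  obtain ⟨m, ⟨eqv⟩⟩ := Finite.exists_equiv_fin τ
  refine ⟨m, S ∘ eqv.symm, fun i => (hS _).1, fun i j hij => hd (eqv.symm.injective.ne hij), ?_,
    fun i => ?_⟩
  · rw [← hu]
    exact eqv.symm.surjective.iUnion_comp S
  · obtain ⟨s, a, L, -, h⟩ := (hS (eqv.symm i)).1.exists_range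
    have ha : a ∈ S (eqv.symm i) := by
      rw [h]
      exact ⟨0, by simp⟩
    refine (hf (g a)).mono fun n hn => ?_
    have := (hS (eqv.symm i)).2 n hn a ha
    simpa using this

theorem monomial_mul_extend [CharZero K] [IsAlgClosed K] {ι : Type} [Fintype ι] (c : ι → Kˣ)
    (b : ι → Fin d → ℕ) (hb : LinearIndependent ℤ (fun (j : ι) (i : Fin d) => (b j i : ℤ)))
    (M : ℕ) (a : Fin d →₀ ℕ) (γ : K) :
    IsRefinedPolyExp (coeffSeq (MvPowerSeries.monomial a γ *
      seqSeries (extend (Fintype.linearCombination ℕ b)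
        (negBinomialCoeff (fun j => (c j : K)) fun _ => M + 1) 0))) := by
  classical
  have hL := (linearIndependent_natCast_iff_injective b).1 hb
  set L := Fintype.linearCombination ℕ b with hLdef
  obtain ⟨q, hq⟩ := exists_eval_eq_multichoose K M
  have hcoeff : ∀ n, coeffSeq (MvPowerSeries.monomial a γ * seqSeries (extend L
      (negBinomialCoeff (fun j => (c j : K)) fun _ => M + 1) 0)) n =
      if ⇑a ≤ n then γ * extend L
      (negBinomialCoeff (fun j => (c j : K)) fun _ => M + 1) 0 (n - a) else 0 := by
    intro n
    have hle : a ≤ Finsupp.equivFunOnFinite.symm n ↔ ⇑a ≤ n := Iff.rfl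
    rw [coeffSeq, MvPowerSeries.coeff_monomial_mul, coeff_seqSeries]
    simp only [hle, Finsupp.coe_tsub, Finsupp.coe_equivFunOnFinite_symm]
  have hrange : (Set.range fun m => ⇑a + L m) =
      Set.range fun m : ι → ℕ => ⇑a + ∑ j, m j • b j := by
    simp only [hLdef, Fintype.linearCombination_apply]
  refine of_isSimpleLinear (isSimpleLinear_range a L hL) ?_ ?_
  · rw [hrange]
    refine IsPolyExpOn.of_coordinates a b hb c q γ fun m => ?_
    have : ∑ j, m j • b j = L m := by rw [hLdef, Fintype.linearCombination_apply]
    rw [hcoeff, if_pos le_self_add, this, add_tsub_cancel_left, hL.extend_apply,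
      negBinomialCoeff]
    simp only [hq]
  · intro n hn
    rw [hcoeff]
    split_ifs with h
    · rw [extend_apply', Pi.zero_apply, mul_zero]
      rintro ⟨m, hm⟩
      exact hn ⟨m, by simp only [hm, add_tsub_cancel_of_le h]⟩
    · rfl

theorem of_mem_independentFractions [CharZero K] [IsAlgClosed K] {G : MvPowerSeries (Fin d) K}
    (hG : G ∈ independentFractions K d) : IsRefinedPolyExp (coeffSeq G) := by
  classical
  obtain ⟨ι, _, c, e, he, N, p, h⟩ := hG
  have hL := (linearIndependent_natCast_iff_injective fun j => ⇑(e j)).1 he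
  set L := Fintype.linearCombination ℕ fun j => ⇑(e j) with hLdef
  -- The exponent `N + 1` instead of `N` keeps it positive, so that the coefficients are polynomial
  -- in `mⱼ`; the surplus factor `v` goes into the numerator.
  have hinv := prod_one_sub_monomial_pow_mul_seqSeries_extend L hL (fun j => (c j : K))
    fun _ => N + 1
  have hLe : ∀ j, Finsupp.equivFunOnFinite.symm (L (Pi.single j 1)) = e j := by
    intro j
    ext
    simp [hLdef]
  simp only [hLe, Finset.prod_pow, ← coe_geometricFactor, ← map_prod] at hinv
  generalize ∏ j, geometricFactor (c j) (e j) = v at h hinv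
  have hG : G = MvPolynomial.coeToMvPowerSeries.ringHom (v * p) * seqSeries (extend L
      (negBinomialCoeff (fun j => (c j : K)) fun _ => N + 1) 0) := by
    rw [map_mul, ← h, map_pow]
    linear_combination (-G) * hinv
  rw [hG, MvPolynomial.coeToMvPowerSeries.ringHom_apply]
  generalize v * p = P
  induction P using MvPolynomial.induction_on' with
  | monomial a γ =>
    rw [MvPolynomial.coe_monomial]
    exact monomial_mul_extend c (fun j => ⇑(e j)) he N a γ
  | add p q hp hq =>
    rw [MvPolynomial.coe_add, add_mul]
    exact hp.add hq

end IsRefinedPolyExp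

theorem HasGeometricDenominator.isPiecewisePolyExp {K : Type*} [Field K] [CharZero K]
    [IsAlgClosed K] {d : ℕ} {F : MvPowerSeries (Fin d) K} (hF : HasGeometricDenominator F) :
    IsPiecewisePolyExp (coeffSeq F) := by
  obtain ⟨l, c, e, he, p, hp⟩ := (hasGeometricDenominator_iff_exists_prod_mul F).1 hF
  refine IsRefinedPolyExp.isPiecewisePolyExp ?_
  have hmem := mem_closure_independentFractions c e he (F := F) ⟨1, p, by
    rw [pow_one, map_prod, hp]
    simp only [coe_geometricFactor]⟩
  clear hF hp
  induction hmem using AddSubmonoid.closure_induction with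
  | mem G hG => exact .of_mem_independentFractions hG
  | zero => exact .zero
  | add G H _ _ hG hH => exact hG.add hH

theorem theorem3p9 {K : Type*} [Field K] [CharZero K] [IsAlgClosed K] {d : ℕ}
    (F : MvPowerSeries (Fin d) K) :
    HasGeometricDenominator F ↔ IsPiecewisePolyExp (coeffSeq F) := by
  refine ⟨fun h => h.isPiecewisePolyExp, fun h => ?_⟩
  rw [← seqSeries_coeffSeq F]
  exact h.isGeometricRational.hasGeometricDenominator
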